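/- A metrized graph $\Gamma$ is a finite connected non-empty graph (loops and multiple edges allowed), with vertex set $V(\Gamma)$ and edge set $E(\Gamma)$, in which each edge $e$ is identified with a segment $[0,L_e]$, $L_e>0$; its total length is $\ell(\Gamma)=\sum_{e} L_e$. It is normalized if $\ell(\Gamma)=1$, and $\Gamma^N$ denotes $\Gamma$ with all lengths divided by $\ell(\Gamma)$. For points $x,y,z\in\Gamma$ let $j_z(x,y)$ be the voltage function: $x\mapsto j_z(x,y)$ is the continuous piecewise affine function with $\Delta_x j_z(x,y)=\delta_y-\delta_z$ and $j_z(z,y)=0$ (the voltage at $x$, relative to $z$, when unit current enters at $y$ and exits at $z$ and each edge has resistance equal to its length). Let $r_\Gamma(x,y)=j_x(y,y)$ be the resistance function, and let $$A_{p,q,\Gamma}=\int_\Gamma j_x(p,q)\Big(\frac{d}{dx}j_p(x,q)\Big)^2dx .$$ The tau constant is $\tau(\Gamma)=\tfrac12\int_\Gamma j_\zeta(x,x)\,d\mu_{can}(\zeta)$, where $\mu_{can}$ is the unique real signed Borel measure of total mass $1$ on $\Gamma$ for which this integral does not depend on $x\in\Gamma$. For an edge $e_i$ of $\Gamma$ of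 length $L_i$, $R_i\in[0,\infty]$ is the resistance between the end points of $e_i$ in $\Gamma-e_i$ ($e_i$ with its interior removed); $R_i=\infty$, and $\frac1{L_i+R_i}=0$, if $\Gamma-e_i$ is disconnected. Let $\Gamma$ be a normalized metrized graph with edges $e_1,\dots,e_e$, each with a labelling of its end points as first and second. For each $i$ let $\beta^i$ be a normalized metrized graph and let $p_i\ne q_i$ be vertices of $\beta^i$. Let $\Gamma\star\prod_i\beta^i_{p_i,q_i}$ be the graph obtained from $\Gamma$ by replacing each edge $e_i$ by a copy of $\beta^i$ with all lengths multiplied by $L_i/r_{\beta^i}(p_i,q_i)$, identifying $p_i$ with the first and $q_i$ with the second end point of $e_i$. If $\beta^i=\beta$, $p_i=p$, $q_i=q$ for all $i$, it is denoted $\Gamma\star\beta_{p,q}$. (1) For normalized metrized graphs $\Gamma$ and $\beta$ and distinct vertices $p,q$ of $\beta$, $(\Gamma\star\beta_{p,q})^N$ is a normalized metrized graph and $$\tau\big((\Gamma\star\beta_{p,q})^N\big)=\tau(\beta)-\frac{r_\beta(p,q)}4+r_\beta(p,q)\,\tau(\Gamma)+\frac{A_{p,q,\beta}}{r_\beta(p,q)}\sum_{e_i\in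 E(\Gamma)}\frac{L_i^2}{L_i+R_i}.$$ (2) In general, $\big(\Gamma\star\prod_i\beta^i_{p_i,q_i}\big)^N$ is a normalized metrized graph and $$\tau\Big(\big(\Gamma\star\textstyle\prod_i\beta^i_{p_i,q_i}\big)^N\Big)\sum_{e_i\in E(\Gamma)}\frac{L_i}{r_{\beta^i}(p_i,q_i)}=\tau(\Gamma)-\frac14+\sum_{e_i\in E(\Gamma)}\left[\frac{L_i\,\tau(\beta^i)}{r_{\beta^i}(p_i,q_i)}+\frac{L_i^2\,A_{p_i,q_i,\beta^i}}{(L_i+R_i)\,r_{\beta^i}(p_i,q_i)^2}\right].$$ -/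

import Mathlib

open MeasureTheory Filter Topology Set
open scoped ENNReal

universe u

noncomputable section

/-- A finite multigraph (loops and multiple edges allowed) with oriented edges and a real length on
each edge.  The orientation records the parametrization of each edge (and thereby a labelling of its
end points).  Connectedness and positivity of lengths are in `LengthGraph.IsMetrizedGraph`. -/
structure LengthGraph where
  /-- vertices -/
  V : Type u
  /-- edges -/
  E : Type u
  finV : Finite V
  fintypeE : Fintype E
  /-- initial end point of an edge -/
  src : E → V
  /-- final end point of an edge -/
  tgt : E → V
  /-- length of an edge -/
  len : E → ℝ

namespace LengthGraph

attribute [instance] LengthGraph.finV LengthGraph.fintypeE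

/-- The graph is connected and non-empty. -/
def Connected (Γ : LengthGraph.{u}) : Prop :=
  Nonempty Γ.V ∧
    ∀ u v : Γ.V, Relation.EqvGen (fun a b => ∃ e : Γ.E, Γ.src e = a ∧ Γ.tgt e = b) u v

/-- Metrized graphs: finite connected graphs with positive edge lengths. -/
def IsMetrizedGraph (Γ : LengthGraph.{u}) : Prop :=
  Γ.Connected ∧ ∀ e : Γ.E, 0 < Γ.len e

/-- The total length `ℓ(Γ)`. -/
def totalLength (Γ : LengthGraph.{u}) : ℝ := ∑ e : Γ.E, Γ.len e

/-- A normalized metrized graph: one of total length `1`. -/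
def IsNormalized (Γ : LengthGraph.{u}) : Prop :=
  Γ.IsMetrizedGraph ∧ Γ.totalLength = 1

/-- Multiply every edge length by `c`. -/
def scale (Γ : LengthGraph.{u}) (c : ℝ) : LengthGraph.{u} :=
  { Γ with len := fun e => c * Γ.len e }

/-- The normalization `Γ^N`. -/
def normalization (Γ : LengthGraph.{u}) : LengthGraph.{u} :=
  Γ.scale (1 / Γ.totalLength)

open Classical in
/-- `Γ - e`: remove the interior of the edge `e`, keeping all vertices. -/
def deleteEdge (Γ : LengthGraph.{u}) (e : Γ.E) : LengthGraph.{u} where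
  V := Γ.V
  E := {e' : Γ.E // e' ≠ e}
  finV := inferInstance
  fintypeE := inferInstance
  src e' := Γ.src e'.1
  tgt e' := Γ.tgt e'.1
  len e' := Γ.len e'.1

/-! ### The underlying space -/

/-- The points of the metrized graph: the vertices, and the interior points of the edges, where
an edge `e` is parametrized by `[0, len e]`. -/
inductive Point (Γ : LengthGraph.{u}) : Type u
  | vertex (v : Γ.V) : Point Γ
  | interior (e : Γ.E) (t : ℝ) (ht : t ∈ Ioo 0 (Γ.len e)) : Point Γ

open Classical in
/-- The parametrization of the closed edge `e` by `[0, len e]`, from `src e` to `tgt e`, extended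
to `ℝ` as a constant on either side. -/
def param (Γ : LengthGraph.{u}) (e : Γ.E) (t : ℝ) : Γ.Point :=
  if h : t ∈ Ioo 0 (Γ.len e) then .interior e t h
  else if t ≤ 0 then .vertex (Γ.src e) else .vertex (Γ.tgt e)

/-- The quotient topology obtained by gluing the closed edges at the vertices: a set is open iff
its preimage under the parametrization of each edge is open. -/
instance (Γ : LengthGraph.{u}) : TopologicalSpace Γ.Point :=
  ⨆ e : Γ.E, TopologicalSpace.coinduced (Γ.param e) inferInstance

/-- The Borel sigma-algebra. -/
instance (Γ : LengthGraph.{u}) : MeasurableSpace Γ.Point := borel Γ.Point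

instance (Γ : LengthGraph.{u}) : BorelSpace Γ.Point := ⟨rfl⟩

/-- The integral `∫_Γ F dx`, where the integrand is given edge by edge in the coordinate of
the edge. -/
def edgeIntegral (Γ : LengthGraph.{u}) (F : Γ.E → ℝ → ℝ) : ℝ :=
  ∑ e : Γ.E, ∫ t in (0 : ℝ)..(Γ.len e), F e t

/-! ### Voltage and resistance -/

open Classical in
/-- The sum of the outgoing directional derivatives of `f` over all directions emanating from a
point. A loop contributes two directions at its vertex. -/
def slopeSum (Γ : LengthGraph.{u}) (f : Γ.Point → ℝ) : Γ.Point → ℝ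
  | .vertex v => ∑ e : Γ.E,
      ((if Γ.src e = v then derivWithin (fun s => f (Γ.param e s)) (Ici 0) 0 else 0) +
        (if Γ.tgt e = v then
          - derivWithin (fun s => f (Γ.param e s)) (Iic (Γ.len e)) (Γ.len e) else 0))
  | .interior e t _ => derivWithin (fun s => f (Γ.param e s)) (Ici t) t -
      derivWithin (fun s => f (Γ.param e s)) (Iic t) t

open Classical in
/-- `f` is the voltage (with reference voltage `0` at `z`) when unit current enters `Γ` at `y` and
exits at `z`: `f` is continuous, it is affine on the segments of the edges between consecutive
points among `y`, `z` and the vertices, and `Δ f = δ_y - δ_z`, where the mass of `Δ f` at a point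
is minus the sum of the outgoing slopes there. -/
structure IsVoltage (Γ : LengthGraph.{u}) (z y : Γ.Point) (f : Γ.Point → ℝ) : Prop where
  ref_eq_zero : f z = 0
  continuous : Continuous f
  locally_affine : ∀ (e : Γ.E) (t : ℝ), t ∈ Ioo 0 (Γ.len e) → Γ.param e t ≠ y → Γ.param e t ≠ z →
    ∃ c : ℝ, ∀ᶠ s in 𝓝 t, f (Γ.param e s) = f (Γ.param e t) + c * (s - t)
  kirchhoff : ∀ x : Γ.Point,
    - Γ.slopeSum f x = (if x = y then 1 else 0) - (if x = z then 1 else 0)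

/-- The voltage function `j_z(x, y)`. -/
def voltage (Γ : LengthGraph.{u}) (z x y : Γ.Point) : ℝ :=
  Classical.epsilon (fun f : Γ.Point → ℝ => Γ.IsVoltage z y f) x

/-- The resistance function `r(x, y) = j_x(y, y)`. -/
def resistance (Γ : LengthGraph.{u}) (x y : Γ.Point) : ℝ := Γ.voltage x y y

/-- `R_e`, the resistance between the end points of the edge `e` in `Γ - e`, equal to `∞` if
`e` is a bridge. -/
def edgeResistance (Γ : LengthGraph.{u}) (e : Γ.E) : ℝ≥0∞ :=
  open Classical in
  if (Γ.deleteEdge e).Connected then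
    ENNReal.ofReal ((Γ.deleteEdge e).resistance (.vertex (Γ.src e)) (.vertex (Γ.tgt e)))
  else ∞

/-- `1 / (L_e + R_e)`, which is `0` if `R_e = ∞`. -/
def invLenAddRes (Γ : LengthGraph.{u}) (e : Γ.E) : ℝ :=
  ((ENNReal.ofReal (Γ.len e) + Γ.edgeResistance e)⁻¹).toReal

/-- `A_{p,q,Γ} = ∫_Γ j_x(p,q) (d/dx j_p(x,q))² dx`. -/
def A (Γ : LengthGraph.{u}) (p q : Γ.Point) : ℝ :=
  Γ.edgeIntegral fun e t =>
    Γ.voltage (Γ.param e t) p q * (deriv (fun s => Γ.voltage p (Γ.param e s) q) t) ^ 2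

/-! ### The tau constant -/

/-- `j_μ(x, y) = ∫_Γ j_ζ(x, y) dμ(ζ)` for a finite signed Borel measure `μ`. -/
def voltageMeasure (Γ : LengthGraph.{u}) (μ : SignedMeasure Γ.Point) (x y : Γ.Point) : ℝ :=
  ∫ᵛ ζ, Γ.voltage ζ x y ∂<•μ

/-- The canonical measure: the signed Borel measure of total mass `1` for which `j_μ(x, x)` is
constant. -/
def IsCanonicalMeasure (Γ : LengthGraph.{u}) (μ : SignedMeasure Γ.Point) : Prop :=
  μ univ = 1 ∧ ∃ c : ℝ, ∀ x : Γ.Point, Γ.voltageMeasure μ x x = c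

/-- The tau constant: the constant value of `j_μ(x, x) / 2` for the canonical measure `μ`. -/
def tau (Γ : LengthGraph.{u}) : ℝ :=
  Classical.epsilon fun t : ℝ => ∃ μ : SignedMeasure Γ.Point,
    Γ.IsCanonicalMeasure μ ∧ ∀ x : Γ.Point, (1 / 2) * Γ.voltageMeasure μ x x = t

/-! ### Full immersion -/

/-- The scaled copy `β_e` of the graph assigned to the edge `e`, in which the resistance between
`p e` and `q e` equals the length of `e`. -/
def scaledCopy (Γ : LengthGraph.{u}) (β : Γ.E → LengthGraph.{u}) (p q : ∀ e, (β e).V) (e : Γ.E) :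
    LengthGraph.{u} :=
  (β e).scale (Γ.len e / (β e).resistance (.vertex (p e)) (.vertex (q e)))

/-- The vertices after the replacement: those of `Γ`, and the vertices of each copy `β_e` other
than `p e` and `q e`. -/
abbrev ImmersionVertex (Γ : LengthGraph.{u}) (β : Γ.E → LengthGraph.{u}) (p q : ∀ e, (β e).V) :
    Type u :=
  Γ.V ⊕ (Σ e : Γ.E, {v : (β e).V // v ≠ p e ∧ v ≠ q e})

open Classical in
/-- How the vertices of the copy `β_e` sit in the new graph: `p e` is identified with the initial
and `q e` with the final end point of `e`. -/
def immersionVertex (Γ : LengthGraph.{u}) (β : Γ.E → LengthGraph.{u}) (p q : ∀ e, (β e).V)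
    (e : Γ.E) (v : (β e).V) : Γ.ImmersionVertex β p q :=
  if hp : v = p e then .inl (Γ.src e)
  else if hq : v = q e then .inl (Γ.tgt e)
  else .inr ⟨e, v, hp, hq⟩

/-- The full immersion `Γ ⋆ ∏ β^e_{p_e,q_e}` (for `p e ≠ q e`): each edge `e` of `Γ` is replaced by
the scaled copy `β_e`. -/
def fullImmersion (Γ : LengthGraph.{u}) (β : Γ.E → LengthGraph.{u}) (p q : ∀ e, (β e).V) :
    LengthGraph.{u} where
  V := Γ.ImmersionVertex β p q
  E := Σ e : Γ.E, (β e).E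
  finV := inferInstance
  fintypeE := inferInstance
  src := fun a => Γ.immersionVertex β p q a.1 ((β a.1).src a.2)
  tgt := fun a => Γ.immersionVertex β p q a.1 ((β a.1).tgt a.2)
  len := fun a => (Γ.scaledCopy β p q a.1).len a.2

end LengthGraph

end

/-! Everything is reduced to linear algebra on the vertices. The Dirichlet form is definite on
functions vanishing at a vertex `o`, so it has a reproducing kernel g there. Interpolating g
affinely in both variables and adding the Dirichlet Green function of each open edge gives a kernel
k on the graph with Δk(·,y) = δ_y - δ_o. Hence j_z(x,y) = k(x,y) - k(x,z) + k(z,z) - k(z,y)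
(`IsGreen.voltage_eq`).

The canonical measure is δ_o plus half the Laplacian of the diagonal x ↦ k(x,x). It integrates
k(·,y) to k(y,y)/2, so the integral of j_z(x,x) over z does not depend on x. Its value makes τ a sum
over edges of ¼[(g(t,t) - g(s,s))²/L + (L - r)²/(3L)], where s, t are the end points of the edge and
r is the resistance between them (`IsGreen.tau_eq`, `tauSum`). The constant A is a finite sum as
well (`IsGreen.A_eq`), and L²/(L+R) = L - r (`IsGreen.len_sq_mul_invLenAddRes`).

The Green function of a full immersion is that of Γ, extended harmonically into each copy, plus the
Green function of the copy with zero boundary values at its two terminals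
(`IsGreen.immersionGreen`). The part of τ carried by one copy therefore depends only on data of β
and on the values of G at the ends of the replaced edge. In `IsGreen.sum_replacement`, subtracting
the right multiples of τ(β) and A from this part leaves an energy of g(·,q) against an explicit
function, which the reproducing property evaluates. The result contains exactly the term of the
replaced edge in τ(Γ). Summation over the edges gives the second formula, and the first is the case
of identical copies. -/

namespace LengthGraph

variable {Γ : LengthGraph.{u}}

/-! ### The Dirichlet form and Green functions on the vertices -/

/-- The Dirichlet form on functions on the vertices. -/
noncomputable def energy (Γ : LengthGraph.{u}) (F H : Γ.V → ℝ) : ℝ :=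
  ∑ e : Γ.E, (F (Γ.tgt e) - F (Γ.src e)) * (H (Γ.tgt e) - H (Γ.src e)) / Γ.len e

theorem energy_comm (F H : Γ.V → ℝ) : Γ.energy F H = Γ.energy H F := by
  unfold energy
  exact Finset.sum_congr rfl fun e _ => by rw [mul_comm (F _ - _)]

theorem energy_add_left (F G H : Γ.V → ℝ) :
    Γ.energy (fun v => F v + G v) H = Γ.energy F H + Γ.energy G H := by
  simp only [energy, ← Finset.sum_add_distrib]
  exact Finset.sum_congr rfl fun e _ => by ring

theorem energy_smul_left (c : ℝ) (F H : Γ.V → ℝ) :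
    Γ.energy (fun v => c * F v) H = c * Γ.energy F H := by
  simp only [energy, Finset.mul_sum]
  exact Finset.sum_congr rfl fun e _ => by ring

theorem energy_add_right (F G H : Γ.V → ℝ) :
    Γ.energy F (fun v => G v + H v) = Γ.energy F G + Γ.energy F H := by
  rw [energy_comm, energy_add_left, energy_comm G, energy_comm H]

theorem energy_smul_right (c : ℝ) (F H : Γ.V → ℝ) :
    Γ.energy F (fun v => c * H v) = c * Γ.energy F H := by
  rw [energy_comm, energy_smul_left, energy_comm]

/-- A function on the vertices of a connected graph that takes the same value at the two end points
of every edge is constant. -/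
theorem Connected.eq_of_forall_edge {α : Type*} (h : Γ.Connected) {F : Γ.V → α}
    (hF : ∀ e, F (Γ.src e) = F (Γ.tgt e)) (u v : Γ.V) : F u = F v := by
  induction h.2 u v with
  | rel x y h => obtain ⟨e, rfl, rfl⟩ := h; exact hF e
  | refl x => rfl
  | symm x y _ ih => exact ih.symm
  | trans x y z _ _ ih₁ ih₂ => exact ih₁.trans ih₂

theorem energy_self_nonneg (hl : ∀ e, 0 < Γ.len e) (F : Γ.V → ℝ) : 0 ≤ Γ.energy F F :=
  Finset.sum_nonneg fun e _ => div_nonneg (mul_self_nonneg _) (hl e).le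

theorem IsMetrizedGraph.eq_of_energy_self_eq_zero (h : Γ.IsMetrizedGraph) {F : Γ.V → ℝ}
    (hF : Γ.energy F F = 0) (u v : Γ.V) : F u = F v := by
  refine h.1.eq_of_forall_edge (fun e => ?_) u v
  have h0 := (Finset.sum_eq_zero_iff_of_nonneg
    fun e _ => div_nonneg (mul_self_nonneg (F (Γ.tgt e) - F (Γ.src e))) (h.2 e).le).1 hF e
    (Finset.mem_univ _)
  rcases div_eq_zero_iff.1 h0 with h1 | h1
  · linarith [mul_self_eq_zero.1 h1]
  · exact absurd h1 (h.2 e).ne'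

/-- `g` is the Green function of `Γ` grounded at `o`: the reproducing kernel of the Dirichlet form on
the functions vanishing at `o`. -/
structure IsGreen (Γ : LengthGraph.{u}) (o : Γ.V) (g : Γ.V → Γ.V → ℝ) : Prop where
  ground : ∀ y, g o y = 0
  energy_eq : ∀ y F, Γ.energy (fun x => g x y) F = F y - F o

/-- The resistance between two vertices in terms of a Green function. -/
def kernelRes {α : Type*} (g : α → α → ℝ) (x y : α) : ℝ := g x x + g y y - 2 * g x y

namespace IsGreen

variable {o : Γ.V} {g : Γ.V → Γ.V → ℝ}

/-- The energy of g(·,x) against g(·,y) can be evaluated by the reproducing property of either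
factor. -/
theorem symm (hg : Γ.IsGreen o g) (x y : Γ.V) : g x y = g y x := by
  have h1 := hg.energy_eq y (fun v => g v x)
  have h2 := hg.energy_eq x (fun v => g v y)
  rw [energy_comm] at h2
  simp only [hg.ground] at h1 h2
  linarith

theorem diag_nonneg (hg : Γ.IsGreen o g) (hl : ∀ e, 0 < Γ.len e) (x : Γ.V) : 0 ≤ g x x := by
  have h := energy_self_nonneg hl (fun v => g v x)
  rw [hg.energy_eq, hg.ground] at h
  linarith

/-- If g(x,x) = 0 then g(·,x) has zero energy and is constant, so it pairs to zero with every
function; but its pairing with the indicator of x must be 1. -/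
theorem diag_pos (hg : Γ.IsGreen o g) (h : Γ.IsMetrizedGraph) {x : Γ.V} (hx : x ≠ o) :
    0 < g x x := by
  refine lt_of_le_of_ne (hg.diag_nonneg h.2 x) fun h0 => ?_
  have h1 := hg.energy_eq x (fun v => g v x)
  rw [hg.ground, ← h0, sub_zero] at h1
  have h2 := h.eq_of_energy_self_eq_zero h1
  classical
  have h3 := hg.energy_eq x (fun v => if v = x then 1 else 0)
  have h4 : Γ.energy (fun v => g v x) (fun v => if v = x then 1 else 0) = 0 :=
    Finset.sum_eq_zero fun e _ => by
      beta_reduce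
      rw [h2 (Γ.tgt e) (Γ.src e), sub_self, zero_mul, zero_div]
  rw [h4] at h3
  simp [hx.symm] at h3

theorem scale (hg : Γ.IsGreen o g) {c : ℝ} (hc : c ≠ 0) :
    (Γ.scale c).IsGreen o (fun x y => c * g x y) where
  ground y := (congrArg (c * ·) (hg.ground y)).trans (mul_zero c)
  energy_eq y F := by
    rw [← hg.energy_eq y F]
    refine Finset.sum_congr rfl fun e _ => ?_
    change (c * g (Γ.tgt e) y - c * g (Γ.src e) y) * (F (Γ.tgt e) - F (Γ.src e)) / (c * Γ.len e) = _
    rw [← mul_sub, mul_assoc, mul_div_mul_left _ _ hc]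

end IsGreen

/-- Riesz representation in finite dimension: the form is definite on functions vanishing at `o`,
hence induces an isomorphism onto the dual, and g(·,y) represents evaluation at y. -/
theorem IsMetrizedGraph.exists_isGreen (h : Γ.IsMetrizedGraph) (o : Γ.V) :
    ∃ g, Γ.IsGreen o g := by
  let W : Submodule ℝ (Γ.V → ℝ) := LinearMap.ker (LinearMap.proj (R := ℝ) (φ := fun _ : Γ.V => ℝ) o)
  have hW : ∀ F : W, F.1 o = 0 := fun F => F.2
  let B : W →ₗ[ℝ] Module.Dual ℝ W := LinearMap.mk₂ ℝ (fun F H => Γ.energy F.1 H.1)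
    (fun F G H => energy_add_left F.1 G.1 H.1) (fun c F H => energy_smul_left c F.1 H.1)
    (fun F G H => energy_add_right F.1 G.1 H.1) (fun c F H => energy_smul_right c F.1 H.1)
  have hB : Function.Injective B := by
    rw [← LinearMap.ker_eq_bot, LinearMap.ker_eq_bot']
    intro F hF
    have h0 : Γ.energy F.1 F.1 = 0 := LinearMap.congr_fun hF F
    ext v
    rw [h.eq_of_energy_self_eq_zero h0 v o, hW]
    rfl
  have hs : Function.Surjective B :=
    (LinearMap.injective_iff_surjective_of_finrank_eq_finrank (Subspace.dual_finrank_eq).symm).1 hB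
  choose G hG using fun y : Γ.V =>
    hs ((LinearMap.proj (R := ℝ) (φ := fun _ : Γ.V => ℝ) y).comp W.subtype)
  refine ⟨fun x y => (G y).1 x, fun y => hW _, fun y F => ?_⟩
  -- F need not vanish at `o`, but F - F(o) does and has the same increments along edges.
  have h1 := LinearMap.congr_fun (hG y) ⟨fun v => F v - F o, by simp [W]⟩
  have h2 : Γ.energy (G y).1 (fun v => F v - F o) = F y - F o := h1
  rw [← h2]
  exact Finset.sum_congr rfl fun e _ => by simp

end LengthGraph

/-! ### One-sided affine germs -/

/-- Near `t`, to the right of it, `φ` is affine of slope `c`. -/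
def HasRightSlope (φ : ℝ → ℝ) (t c : ℝ) : Prop := ∀ᶠ s in 𝓝[≥] t, φ s = φ t + c * (s - t)

/-- Near `t`, to the left of it, `φ` is affine of slope `c`. -/
def HasLeftSlope (φ : ℝ → ℝ) (t c : ℝ) : Prop := ∀ᶠ s in 𝓝[≤] t, φ s = φ t + c * (s - t)

section Slopes

variable {φ ψ : ℝ → ℝ} {t c d : ℝ}

theorem HasRightSlope.derivWithin_eq (h : HasRightSlope φ t c) : derivWithin φ (Ici t) t = c := by
  have h1 : HasDerivWithinAt (fun s => φ t + c * (s - t)) c (Ici t) t := by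
    simpa using (((hasDerivAt_id t).sub_const t).const_mul c).const_add (φ t) |>.hasDerivWithinAt
  exact (h1.congr_of_eventuallyEq h (by simp)).derivWithin (uniqueDiffOn_Ici t t self_mem_Ici)

theorem HasLeftSlope.derivWithin_eq (h : HasLeftSlope φ t c) : derivWithin φ (Iic t) t = c := by
  have h1 : HasDerivWithinAt (fun s => φ t + c * (s - t)) c (Iic t) t := by
    simpa using (((hasDerivAt_id t).sub_const t).const_mul c).const_add (φ t) |>.hasDerivWithinAt
  exact (h1.congr_of_eventuallyEq h (by simp)).derivWithin (uniqueDiffOn_Iic t t self_mem_Iic)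

theorem HasRightSlope.add (h : HasRightSlope φ t c) (h' : HasRightSlope ψ t d) :
    HasRightSlope (fun s => φ s + ψ s) t (c + d) := by
  filter_upwards [h, h'] with s h1 h2
  rw [h1, h2]; ring

theorem HasLeftSlope.add (h : HasLeftSlope φ t c) (h' : HasLeftSlope ψ t d) :
    HasLeftSlope (fun s => φ s + ψ s) t (c + d) := by
  filter_upwards [h, h'] with s h1 h2
  rw [h1, h2]; ring

theorem HasRightSlope.sub (h : HasRightSlope φ t c) (h' : HasRightSlope ψ t d) :
    HasRightSlope (fun s => φ s - ψ s) t (c - d) := by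
  filter_upwards [h, h'] with s h1 h2
  rw [h1, h2]; ring

theorem HasLeftSlope.sub (h : HasLeftSlope φ t c) (h' : HasLeftSlope ψ t d) :
    HasLeftSlope (fun s => φ s - ψ s) t (c - d) := by
  filter_upwards [h, h'] with s h1 h2
  rw [h1, h2]; ring

theorem HasRightSlope.eventually_nhds (h : HasRightSlope φ t c) (h' : HasLeftSlope φ t c) :
    ∀ᶠ s in 𝓝 t, φ s = φ t + c * (s - t) := by
  rw [← nhdsLE_sup_nhdsGE, eventually_sup]
  exact ⟨h', h⟩

/-- A function that is continuous on `[a, b]` and locally affine inside is affine on `[a, b]`. -/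
theorem affineOn_of_locally_affine {a b : ℝ} (hab : a < b) (hφ : ContinuousOn φ (Icc a b))
    (h : ∀ t ∈ Ioo a b, ∃ c : ℝ, ∀ᶠ s in 𝓝 t, φ s = φ t + c * (s - t)) :
    ∃ c : ℝ, ∀ s ∈ Icc a b, φ s = φ a + c * (s - a) := by
  have hd : ∀ t ∈ Ioo a b, ∃ c : ℝ, ∀ᶠ s in 𝓝 t, HasDerivAt φ c s := by
    intro t ht
    obtain ⟨c, hc⟩ := h t ht
    refine ⟨c, hc.eventually_nhds.mono fun s hs => ?_⟩
    have h1 : HasDerivAt (fun s => φ t + c * (s - t)) c s := by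
      simpa using (((hasDerivAt_id s).sub_const t).const_mul c).const_add (φ t)
    exact h1.congr_of_eventuallyEq hs
  have hmid : (a + b) / 2 ∈ Ioo a b := ⟨by linarith, by linarith⟩
  -- The derivative is locally constant, hence constant on the connected interior; the midpoint
  -- merely names its value. The mean value theorem then reaches the end points, where only
  -- continuity is known.
  have hconst : ∀ t ∈ Ioo a b, HasDerivAt φ (deriv φ ((a + b) / 2)) t := by
    intro t ht
    have hdd : ∀ s ∈ Ioo a b, HasDerivAt (deriv φ) 0 s := fun s hs => by
      obtain ⟨c, hc⟩ := hd s hs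
      exact (hasDerivAt_const s c).congr_of_eventuallyEq (hc.mono fun _ h => h.deriv)
    have h1 := isOpen_Ioo.is_const_of_deriv_eq_zero isPreconnected_Ioo
      (fun s hs => (hdd s hs).differentiableAt.differentiableWithinAt)
      (fun s hs => (hdd s hs).deriv) hmid ht
    obtain ⟨c, hc⟩ := hd t ht
    rw [h1]
    exact hc.self_of_nhds.differentiableAt.hasDerivAt
  refine ⟨deriv φ ((a + b) / 2), fun s hs => ?_⟩
  rcases hs.1.eq_or_lt with rfl | has
  · simp
  obtain ⟨x, -, hx⟩ := exists_hasDerivAt_eq_slope φ (fun _ => deriv φ ((a + b) / 2)) has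
    (hφ.mono (Icc_subset_Icc_right hs.2)) fun x hx => hconst x ⟨hx.1, hx.2.trans_le hs.2⟩
  rw [hx, div_mul_cancel₀ _ (sub_pos.2 has).ne']
  ring

end Slopes

namespace LengthGraph

variable {Γ : LengthGraph.{u}}

/-! ### Points and functions on the graph -/

theorem param_of_mem {e : Γ.E} {t : ℝ} (ht : t ∈ Ioo 0 (Γ.len e)) :
    Γ.param e t = .interior e t ht := by
  simp [param, ht]

theorem param_zero (e : Γ.E) : Γ.param e 0 = .vertex (Γ.src e) := by
  simp [param]

theorem param_len {e : Γ.E} (he : 0 < Γ.len e) : Γ.param e (Γ.len e) = .vertex (Γ.tgt e) := by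
  simp [param, he]

theorem param_eq_interior_iff {e e' : Γ.E} {s t : ℝ} {ht : t ∈ Ioo 0 (Γ.len e')} :
    Γ.param e s = .interior e' t ht ↔ e = e' ∧ s = t := by
  unfold param
  split_ifs with h1 h2
  · constructor
    · rintro h; cases h; exact ⟨rfl, rfl⟩
    · rintro ⟨rfl, rfl⟩; rfl
  · simp only [false_iff]
    rintro ⟨rfl, rfl⟩; exact h1 ht
  · simp only [false_iff]
    rintro ⟨rfl, rfl⟩; exact h1 ht

theorem continuous_param (e : Γ.E) : Continuous (Γ.param e) :=
  continuous_iSup_rng (i := e) continuous_coinduced_rng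

theorem continuous_iff_forall_edge {α : Type*} [TopologicalSpace α] {f : Γ.Point → α} :
    Continuous f ↔ ∀ e, Continuous fun s => f (Γ.param e s) := by
  rw [continuous_iSup_dom]
  exact forall_congr' fun e => continuous_coinduced_dom

/-- The nearest point of `[0, len e]`. -/
noncomputable def clamp (Γ : LengthGraph.{u}) (e : Γ.E) (s : ℝ) : ℝ := max 0 (min s (Γ.len e))

theorem continuous_clamp (e : Γ.E) : Continuous (Γ.clamp e) :=
  continuous_const.max (continuous_id.min continuous_const)

theorem clamp_of_mem {e : Γ.E} {s : ℝ} (hs : s ∈ Icc 0 (Γ.len e)) : Γ.clamp e s = s := by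
  rw [clamp, min_eq_left hs.2, max_eq_right hs.1]

/-- The function on `Γ` that is affine on each edge with given values at the vertices. -/
noncomputable def interp (u : Γ.V → ℝ) : Γ.Point → ℝ
  | .vertex v => u v
  | .interior e t _ => u (Γ.src e) + (u (Γ.tgt e) - u (Γ.src e)) * (t / Γ.len e)

open Classical in
/-- The Dirichlet Green function with pole `y` of the interior of the edge `e`, in the coordinate of
that edge; it is `0` if `y` is not an interior point of `e`. -/
noncomputable def tent (e : Γ.E) : Γ.Point → ℝ → ℝ
  | .vertex _, _ => 0
  | .interior e' t _, s => if e' = e then min s t - s * t / Γ.len e else 0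

open Classical in
/-- The right derivative of `tent e y`. -/
noncomputable def tentRight (e : Γ.E) : Γ.Point → ℝ → ℝ
  | .vertex _, _ => 0
  | .interior e' t _, s => if e' = e then (if s < t then 1 else 0) - t / Γ.len e else 0

open Classical in
/-- The left derivative of `tent e y`. -/
noncomputable def tentLeft (e : Γ.E) : Γ.Point → ℝ → ℝ
  | .vertex _, _ => 0
  | .interior e' t _, s => if e' = e then (if s ≤ t then 1 else 0) - t / Γ.len e else 0

/-- The Dirichlet Green function of the complement of the vertices. -/
noncomputable def bump : Γ.Point → Γ.Point → ℝ
  | .vertex _, _ => 0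
  | .interior e s _, y => tent e y s

/-- Since `param` is constant outside `[0, len e]`, coordinate formulas valid on all of `ℝ` must be
evaluated at the clamped coordinate. -/
theorem interp_param {e : Γ.E} (he : 0 < Γ.len e) (u : Γ.V → ℝ) (s : ℝ) :
    interp u (Γ.param e s) =
      u (Γ.src e) + (u (Γ.tgt e) - u (Γ.src e)) * (Γ.clamp e s / Γ.len e) := by
  unfold param
  split_ifs with h1 h2
  · rw [clamp_of_mem ⟨h1.1.le, h1.2.le⟩]; rfl
  · rw [clamp, max_eq_left ((min_le_left _ _).trans h2)]; simp [interp]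
  · have : Γ.len e ≤ s := by
      by_contra h; exact h1 ⟨not_le.1 h2, not_le.1 h⟩
    rw [clamp, min_eq_right this, max_eq_right he.le, div_self he.ne']; simp [interp]

theorem bump_param {e : Γ.E} (he : 0 < Γ.len e) (y : Γ.Point) (s : ℝ) :
    bump (Γ.param e s) y = tent e y (Γ.clamp e s) := by
  unfold param
  split_ifs with h1 h2
  · rw [clamp_of_mem ⟨h1.1.le, h1.2.le⟩]; rfl
  · rw [clamp, max_eq_left ((min_le_left _ _).trans h2)]
    rcases y with v | ⟨e', t, ht⟩
    · simp [bump, tent]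
    · simp [bump, tent, ht.1.le]
  · have : Γ.len e ≤ s := by
      by_contra h; exact h1 ⟨not_le.1 h2, not_le.1 h⟩
    rw [clamp, min_eq_right this, max_eq_right he.le]
    rcases y with v | ⟨e', t, ht⟩
    · simp [bump, tent]
    · simp only [bump, tent]
      split_ifs with h
      · subst h
        rw [min_eq_right ht.2.le]; field_simp; simp
      · rfl

theorem bump_comm (x y : Γ.Point) : bump x y = bump y x := by
  rcases x with v | ⟨e, s, hs⟩ <;> rcases y with w | ⟨e', t, ht⟩ <;> simp only [bump, tent]
  by_cases h : e = e'
  · subst h; simp [min_comm, mul_comm]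
  · simp [h, Ne.symm h]

theorem continuous_tent (e : Γ.E) (y : Γ.Point) : Continuous (tent e y) := by
  rcases y with v | ⟨e', t, ht⟩
  · exact continuous_const
  · change Continuous fun s => tent e (.interior e' t ht) s
    simp only [tent]
    split_ifs
    · fun_prop
    · exact continuous_const

theorem continuous_interp (hl : ∀ e, 0 < Γ.len e) (u : Γ.V → ℝ) : Continuous (interp u) := by
  rw [continuous_iff_forall_edge]
  intro e
  simp only [interp_param (hl e)]
  exact continuous_const.add (continuous_const.mul ((continuous_clamp e).div_const _))

theorem continuous_bump (hl : ∀ e, 0 < Γ.len e) (y : Γ.Point) : Continuous fun x => bump x y := by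
  rw [continuous_iff_forall_edge]
  intro e
  simp only [bump_param (hl e)]
  exact (continuous_tent e y).comp (continuous_clamp e)

/-! ### One-sided slopes and Laplacians of piecewise affine functions -/

theorem tentRight_spec (e : Γ.E) (y : Γ.Point) (s : ℝ) :
    HasRightSlope (tent e y) s (tentRight e y s) := by
  rcases y with v | ⟨e', t, ht⟩
  · exact Eventually.of_forall fun _ => by simp [tent, tentRight]
  · by_cases he : e' = e
    · rcases lt_or_ge s t with hst | hst
      · filter_upwards [mem_nhdsWithin_of_mem_nhds (Iio_mem_nhds hst)] with r hr
        simp only [tent, tentRight, if_pos he, if_pos hst, min_eq_left (mem_Iio.1 hr).le,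
          min_eq_left hst.le]
        ring
      · filter_upwards [self_mem_nhdsWithin] with r hr
        simp only [tent, tentRight, if_pos he, if_neg hst.not_gt, min_eq_right (hst.trans hr),
          min_eq_right hst]
        ring
    · exact Eventually.of_forall fun _ => by simp [tent, tentRight, he]

theorem tentLeft_spec (e : Γ.E) (y : Γ.Point) (s : ℝ) :
    HasLeftSlope (tent e y) s (tentLeft e y s) := by
  rcases y with v | ⟨e', t, ht⟩
  · exact Eventually.of_forall fun _ => by simp [tent, tentLeft]
  · by_cases he : e' = e
    · rcases lt_or_ge t s with hst | hst
      · filter_upwards [mem_nhdsWithin_of_mem_nhds (Ioi_mem_nhds hst)] with r hr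
        simp only [tent, tentLeft, if_pos he, if_neg hst.not_ge, min_eq_right (mem_Ioi.1 hr).le,
          min_eq_right hst.le]
        ring
      · filter_upwards [self_mem_nhdsWithin] with r hr
        simp only [tent, tentLeft, if_pos he, if_pos hst, min_eq_left (le_trans hr hst),
          min_eq_left hst]
        ring
    · exact Eventually.of_forall fun _ => by simp [tent, tentLeft, he]

/-- The one-sided slopes of `f` along the edges are `R` and `S`, and `f` is affine near each point on
either side of it. -/
structure HasSlopes (f : Γ.Point → ℝ) (R S : Γ.E → ℝ → ℝ) : Prop where
  right : ∀ e, ∀ t ∈ Ico 0 (Γ.len e), HasRightSlope (fun s => f (Γ.param e s)) t (R e t)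
  left : ∀ e, ∀ t ∈ Ioc 0 (Γ.len e), HasLeftSlope (fun s => f (Γ.param e s)) t (S e t)

namespace HasSlopes

variable {f f' : Γ.Point → ℝ} {R S R' S' : Γ.E → ℝ → ℝ}

theorem add (h : HasSlopes f R S) (h' : HasSlopes f' R' S') :
    HasSlopes (fun x => f x + f' x) (fun e t => R e t + R' e t) (fun e t => S e t + S' e t) :=
  ⟨fun e t ht => (h.right e t ht).add (h'.right e t ht),
    fun e t ht => (h.left e t ht).add (h'.left e t ht)⟩

theorem sub (h : HasSlopes f R S) (h' : HasSlopes f' R' S') :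
    HasSlopes (fun x => f x - f' x) (fun e t => R e t - R' e t) (fun e t => S e t - S' e t) :=
  ⟨fun e t ht => (h.right e t ht).sub (h'.right e t ht),
    fun e t ht => (h.left e t ht).sub (h'.left e t ht)⟩

open Classical in
theorem slopeSum_vertex (hl : ∀ e, 0 < Γ.len e) (h : HasSlopes f R S) (v : Γ.V) :
    Γ.slopeSum f (.vertex v) = ∑ e : Γ.E, ((if Γ.src e = v then R e 0 else 0) +
      (if Γ.tgt e = v then - S e (Γ.len e) else 0)) := by
  unfold slopeSum
  refine Finset.sum_congr rfl fun e _ => ?_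
  rw [(h.right e 0 ⟨le_rfl, hl e⟩).derivWithin_eq,
    (h.left e _ ⟨hl e, le_rfl⟩).derivWithin_eq]

theorem slopeSum_interior (h : HasSlopes f R S) (e : Γ.E) (t : ℝ) (ht : t ∈ Ioo 0 (Γ.len e)) :
    Γ.slopeSum f (.interior e t ht) = R e t - S e t := by
  simp only [slopeSum]
  rw [(h.right e t ⟨ht.1.le, ht.2⟩).derivWithin_eq, (h.left e t ⟨ht.1, ht.2.le⟩).derivWithin_eq]

theorem slopeSum_add (hl : ∀ e, 0 < Γ.len e) (h : HasSlopes f R S) (h' : HasSlopes f' R' S')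
    (x : Γ.Point) :
    Γ.slopeSum (fun x => f x + f' x) x = Γ.slopeSum f x + Γ.slopeSum f' x := by
  rcases x with v | ⟨e, t, ht⟩
  · rw [(h.add h').slopeSum_vertex hl, h.slopeSum_vertex hl, h'.slopeSum_vertex hl,
      ← Finset.sum_add_distrib]
    refine Finset.sum_congr rfl fun e _ => ?_
    split_ifs <;> ring
  · rw [(h.add h').slopeSum_interior, h.slopeSum_interior, h'.slopeSum_interior]
    ring

theorem slopeSum_sub (hl : ∀ e, 0 < Γ.len e) (h : HasSlopes f R S) (h' : HasSlopes f' R' S')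
    (x : Γ.Point) :
    Γ.slopeSum (fun x => f x - f' x) x = Γ.slopeSum f x - Γ.slopeSum f' x := by
  rcases x with v | ⟨e, t, ht⟩
  · rw [(h.sub h').slopeSum_vertex hl, h.slopeSum_vertex hl, h'.slopeSum_vertex hl,
      ← Finset.sum_sub_distrib]
    refine Finset.sum_congr rfl fun e _ => ?_
    split_ifs <;> ring
  · rw [(h.sub h').slopeSum_interior, h.slopeSum_interior, h'.slopeSum_interior]
    ring

/-- Near interior points of an edge where the two slopes agree, the function is affine. -/
theorem locally_affine (h : HasSlopes f R S) {e : Γ.E} {t : ℝ} (ht : t ∈ Ioo 0 (Γ.len e))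
    (hRS : R e t = S e t) :
    ∃ c : ℝ, ∀ᶠ s in 𝓝 t, f (Γ.param e s) = f (Γ.param e t) + c * (s - t) :=
  ⟨R e t, (h.right e t ⟨ht.1.le, ht.2⟩).eventually_nhds (hRS ▸ h.left e t ⟨ht.1, ht.2.le⟩)⟩

/-- Functions whose expression in the coordinate of each edge has the given slopes. -/
theorem of_clamp {φ : Γ.E → ℝ → ℝ} (hf : ∀ e s, f (Γ.param e s) = φ e (Γ.clamp e s))
    (hR : ∀ e, ∀ t ∈ Ico 0 (Γ.len e), HasRightSlope (φ e) t (R e t))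
    (hS : ∀ e, ∀ t ∈ Ioc 0 (Γ.len e), HasLeftSlope (φ e) t (S e t)) : HasSlopes f R S := by
  refine ⟨fun e t ht => ?_, fun e t ht => ?_⟩
  · filter_upwards [hR e t ht, self_mem_nhdsWithin,
      mem_nhdsWithin_of_mem_nhds (Iio_mem_nhds ht.2)] with s h1 h2 h3
    rw [hf, hf, clamp_of_mem ⟨ht.1.trans h2, le_of_lt h3⟩, clamp_of_mem ⟨ht.1, ht.2.le⟩, h1]
  · filter_upwards [hS e t ht, self_mem_nhdsWithin,
      mem_nhdsWithin_of_mem_nhds (Ioi_mem_nhds ht.1)] with s h1 h2 h3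
    rw [hf, hf, clamp_of_mem ⟨le_of_lt h3, le_trans h2 ht.2⟩, clamp_of_mem ⟨ht.1.le, ht.2⟩, h1]

end HasSlopes

theorem hasSlopes_interp (hl : ∀ e, 0 < Γ.len e) (u : Γ.V → ℝ) :
    HasSlopes (interp u) (fun e _ => (u (Γ.tgt e) - u (Γ.src e)) / Γ.len e)
      (fun e _ => (u (Γ.tgt e) - u (Γ.src e)) / Γ.len e) :=
  HasSlopes.of_clamp
    (φ := fun e s => u (Γ.src e) + (u (Γ.tgt e) - u (Γ.src e)) * (s / Γ.len e))
    (fun e s => interp_param (hl e) u s)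
    (fun e t _ => Eventually.of_forall fun s => by ring)
    (fun e t _ => Eventually.of_forall fun s => by ring)

theorem hasSlopes_bump (hl : ∀ e, 0 < Γ.len e) (y : Γ.Point) :
    HasSlopes (fun x => bump x y) (fun e => tentRight e y) (fun e => tentLeft e y) :=
  HasSlopes.of_clamp (fun e s => bump_param (hl e) y s)
    (fun e t _ => tentRight_spec e y t) (fun e t _ => tentLeft_spec e y t)

theorem hasSlopes_const (c : ℝ) : HasSlopes (fun _ : Γ.Point => c) (fun _ _ => 0) (fun _ _ => 0) :=
  ⟨fun _ _ _ => Eventually.of_forall fun _ => by simp,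
    fun _ _ _ => Eventually.of_forall fun _ => by simp⟩

theorem slopeSum_const (c : ℝ) (hl : ∀ e, 0 < Γ.len e) (x : Γ.Point) :
    Γ.slopeSum (fun _ => c) x = 0 := by
  rcases x with v | ⟨e, t, ht⟩
  · rw [(hasSlopes_const c).slopeSum_vertex hl]; simp
  · rw [(hasSlopes_const c).slopeSum_interior]; simp

open Classical in
-- Pairing with the indicator of v selects the edges at v with the correct signs, and a loop
-- contributes zero on both sides. Kirchhoff's law at vertices thus becomes a statement about
-- energies.
theorem slopeSum_interp_vertex (hl : ∀ e, 0 < Γ.len e) (u : Γ.V → ℝ) (v : Γ.V) :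
    Γ.slopeSum (interp u) (.vertex v) = - Γ.energy u (fun w => if w = v then 1 else 0) := by
  rw [(hasSlopes_interp hl u).slopeSum_vertex hl, energy, ← Finset.sum_neg_distrib]
  refine Finset.sum_congr rfl fun e _ => ?_
  split_ifs <;> ring

open Classical in
-- The current from the pole splits between the two ends in proportion to the barycentric
-- coordinates 1 - t/L and t/L of the pole.
theorem slopeSum_bump_vertex (hl : ∀ e, 0 < Γ.len e) (e : Γ.E) (t : ℝ) (ht : t ∈ Ioo 0 (Γ.len e))
    (v : Γ.V) :
    Γ.slopeSum (fun x => bump x (.interior e t ht)) (.vertex v) =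
      interp (fun w => if w = v then 1 else 0) (.interior e t ht) := by
  rw [(hasSlopes_bump hl _).slopeSum_vertex hl, Finset.sum_eq_single e]
  · simp only [tentRight, tentLeft, interp, if_true, ht.1, ht.2.not_ge, if_false]
    split_ifs <;> ring
  · intro e' _ he
    simp [tentRight, tentLeft, he.symm]
  · simp

open Classical in
theorem slopeSum_bump_interior (hl : ∀ e, 0 < Γ.len e) (y : Γ.Point) (e : Γ.E) (t : ℝ)
    (ht : t ∈ Ioo 0 (Γ.len e)) :
    Γ.slopeSum (fun x => bump x y) (.interior e t ht) =
      - (if Point.interior e t ht = y then 1 else 0) := by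
  rw [(hasSlopes_bump hl _).slopeSum_interior]
  rcases y with v | ⟨e', s, hs⟩
  · simp [tentRight, tentLeft]
  · simp only [tentRight, tentLeft]
    by_cases he : e' = e
    · subst he
      rcases lt_trichotomy t s with h | rfl | h
      · simp [h, h.le, h.ne]
      · simp only [lt_irrefl, le_refl, if_true, if_false]; ring
      · simp [h.not_ge, h.not_gt, h.ne']
    · simp [he, Ne.symm he]

/-! ### The voltage function in terms of a Green function -/

/-- The extension to `Γ` of a Green function on the vertices. -/
noncomputable def kernel (g : Γ.V → Γ.V → ℝ) (x y : Γ.Point) : ℝ :=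
  interp (fun v => interp (g v) y) x + bump x y

theorem hasSlopes_kernel (hl : ∀ e, 0 < Γ.len e) (g : Γ.V → Γ.V → ℝ) (y : Γ.Point) :
    HasSlopes (fun x => kernel g x y)
      (fun e t => (interp (g (Γ.tgt e)) y - interp (g (Γ.src e)) y) / Γ.len e + tentRight e y t)
      (fun e t => (interp (g (Γ.tgt e)) y - interp (g (Γ.src e)) y) / Γ.len e + tentLeft e y t) :=
  (hasSlopes_interp hl _).add (hasSlopes_bump hl y)

theorem continuous_kernel (hl : ∀ e, 0 < Γ.len e) (g : Γ.V → Γ.V → ℝ) (y : Γ.Point) :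
    Continuous fun x => kernel g x y :=
  (continuous_interp hl _).add (continuous_bump hl y)

theorem tentRight_eq_tentLeft {e : Γ.E} {y : Γ.Point} {t : ℝ} (h : Γ.param e t ≠ y) :
    tentRight e y t = tentLeft e y t := by
  rcases y with v | ⟨e', s, hs⟩
  · rfl
  · rw [Ne, param_eq_interior_iff] at h
    simp only [tentRight, tentLeft]
    by_cases he : e' = e
    · rcases lt_trichotomy t s with h' | rfl | h'
      · simp [h', h'.le]
      · exact absurd ⟨he.symm, rfl⟩ h
      · simp [h'.not_ge, h'.not_gt]
    · simp [he]

theorem interp_interp_comm (g : Γ.V → Γ.V → ℝ) (x y : Γ.Point) :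
    interp (fun v => interp (g v) y) x = interp (fun w => interp (fun v => g v w) x) y := by
  rcases x with v | ⟨e, s, hs⟩ <;> rcases y with w | ⟨e', t, ht⟩ <;> simp only [interp]
  ring

variable {o : Γ.V} {g : Γ.V → Γ.V → ℝ}

theorem IsGreen.kernel_comm (hg : Γ.IsGreen o g) (x y : Γ.Point) : kernel g x y = kernel g y x := by
  have : g = fun v w => g w v := by ext v w; exact hg.symm v w
  rw [kernel, kernel, bump_comm x y, interp_interp_comm]
  conv_lhs => rw [this]

theorem IsGreen.energy_interp (hg : Γ.IsGreen o g) (y : Γ.Point) (F : Γ.V → ℝ) :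
    Γ.energy (fun v => interp (g v) y) F = interp F y - F o := by
  rcases y with w | ⟨e, t, ht⟩
  · exact hg.energy_eq w F
  · have h : (fun v => interp (g v) (.interior e t ht)) = fun v =>
        (1 - t / Γ.len e) * g v (Γ.src e) + (t / Γ.len e) * g v (Γ.tgt e) := by
      ext v; simp only [interp]; ring
    rw [h, energy_add_left, energy_smul_left, energy_smul_left, hg.energy_eq, hg.energy_eq]
    simp only [interp]
    ring

open Classical in
-- At a vertex, the interpolated part produces the barycentric weight of y, which the tent cancels
-- if y is inside an edge and which is the point mass itself if y is a vertex. Inside edges only the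
-- tent has a kink.
theorem IsGreen.slopeSum_kernel (hg : Γ.IsGreen o g) (hl : ∀ e, 0 < Γ.len e) (x y : Γ.Point) :
    Γ.slopeSum (fun x => kernel g x y) x =
      (if x = .vertex o then 1 else 0) - (if x = y then 1 else 0) := by
  unfold kernel
  rw [(hasSlopes_interp hl _).slopeSum_add hl (hasSlopes_bump hl y)]
  rcases x with v | ⟨e, t, ht⟩
  · rw [slopeSum_interp_vertex hl, hg.energy_interp]
    rcases y with w | ⟨e', t', ht'⟩
    · have : Γ.slopeSum (fun x => bump x (.vertex w)) (.vertex v) = 0 := by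
        rw [(hasSlopes_bump hl _).slopeSum_vertex hl]
        simp [tentRight, tentLeft]
      rw [this]
      simp only [interp, Point.vertex.injEq, eq_comm (a := v)]
      ring
    · rw [slopeSum_bump_vertex hl]
      simp only [Point.vertex.injEq, eq_comm (a := v), reduceCtorEq, if_false]
      ring
  · rw [(hasSlopes_interp hl _).slopeSum_interior, slopeSum_bump_interior hl]
    simp

/-- The four-term expression of the voltage function by a Green function. -/
noncomputable def kernelVoltage (g : Γ.V → Γ.V → ℝ) (z x y : Γ.Point) : ℝ :=
  kernel g x y - kernel g x z + (kernel g z z - kernel g z y)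

/-- The sink at `o` cancels in k(·,y) - k(·,z), and the added constant normalizes the value at z. -/
theorem IsGreen.isVoltage (hg : Γ.IsGreen o g) (hl : ∀ e, 0 < Γ.len e) (z y : Γ.Point) :
    Γ.IsVoltage z y (fun x => kernelVoltage g z x y) := by
  have hs := ((hasSlopes_kernel hl g y).sub (hasSlopes_kernel hl g z))
  have hs' := hs.add (hasSlopes_const (kernel g z z - kernel g z y))
  refine ⟨by simp [kernelVoltage], ?_, fun e t ht hy hz => ?_, fun x => ?_⟩
  · exact ((continuous_kernel hl g y).sub (continuous_kernel hl g z)).add continuous_const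
  · exact hs'.locally_affine ht (by
      rw [tentRight_eq_tentLeft hy, tentRight_eq_tentLeft hz])
  · unfold kernelVoltage
    rw [hs.slopeSum_add hl (hasSlopes_const _), slopeSum_const _ hl,
      (hasSlopes_kernel hl g y).slopeSum_sub hl (hasSlopes_kernel hl g z), hg.slopeSum_kernel hl,
      hg.slopeSum_kernel hl]
    ring


/-! ### Uniqueness of the voltage function -/

/-- `B e` holds the finitely many coordinates of y and z inside e. Each side of any point has a
short interval avoiding `B e`, where local affinity and continuity up to the ends give an affine
germ. -/
theorem IsVoltage.exists_hasSlopes {z y : Γ.Point} {f : Γ.Point → ℝ} (hf : Γ.IsVoltage z y f) :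
    ∃ R S, HasSlopes f R S := by
  set B : Γ.E → Set ℝ := fun e =>
    {s | (Γ.param e s = y ∨ Γ.param e s = z) ∧ s ∈ Ioo 0 (Γ.len e)} with hB
  have hfin : ∀ e, (B e).Finite := by
    have : ∀ (x : Γ.Point) e, {s | Γ.param e s = x ∧ s ∈ Ioo 0 (Γ.len e)}.Finite := by
      intro x e
      refine Set.Subsingleton.finite ?_
      rintro s ⟨h1, h2⟩ t ⟨h3, h4⟩
      rw [← h3, param_of_mem h4, param_eq_interior_iff] at h1
      exact h1.2
    refine fun e => ((this y e).union (this z e)).subset ?_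
    rintro s ⟨h1 | h1, h2⟩
    exacts [Or.inl ⟨h1, h2⟩, Or.inr ⟨h1, h2⟩]
  have hnear : ∀ e t, ∀ᶠ s in 𝓝 t, s ≠ t → s ∉ B e := fun e t => by
    filter_upwards [((hfin e).subset (sdiff_subset (t := {t}))).isClosed.isOpen_compl.mem_nhds
      (x := t) (by simp)] with s hs hst h
    exact hs ⟨h, hst⟩
  have haff : ∀ e a b, 0 ≤ a → b ≤ Γ.len e → a < b → (∀ s ∈ Ioo a b, s ∉ B e) →
      ∃ c : ℝ, ∀ s ∈ Icc a b, f (Γ.param e s) = f (Γ.param e a) + c * (s - a) := by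
    intro e a b ha hb hab h
    refine affineOn_of_locally_affine hab (hf.continuous.comp (continuous_param e)).continuousOn
      fun t ht => ?_
    have ht' : t ∈ Ioo 0 (Γ.len e) := ⟨ha.trans_lt ht.1, ht.2.trans_le hb⟩
    exact hf.locally_affine e t ht' (fun h' => h t ht ⟨Or.inl h', ht'⟩)
      (fun h' => h t ht ⟨Or.inr h', ht'⟩)
  have hR : ∀ e t, t ∈ Ico 0 (Γ.len e) → ∃ c, HasRightSlope (fun s => f (Γ.param e s)) t c := by
    intro e t ht
    have h1 : ∀ᶠ s in 𝓝[>] t, s ∉ B e := by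
      filter_upwards [mem_nhdsWithin_of_mem_nhds (hnear e t), self_mem_nhdsWithin] with s hs hs'
      exact hs (ne_of_gt hs')
    obtain ⟨b, hb, hb'⟩ := mem_nhdsGT_iff_exists_Ioo_subset.1 h1
    have hm : t < min b (Γ.len e) := lt_min hb ht.2
    obtain ⟨c, hc⟩ := haff e t _ ht.1 (min_le_right b _) hm
      fun s hs => hb' ⟨hs.1, hs.2.trans_le (min_le_left _ _)⟩
    exact ⟨c, mem_of_superset (Icc_mem_nhdsGE hm) hc⟩
  have hS : ∀ e t, t ∈ Ioc 0 (Γ.len e) → ∃ c, HasLeftSlope (fun s => f (Γ.param e s)) t c := by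
    intro e t ht
    have h1 : ∀ᶠ s in 𝓝[<] t, s ∉ B e := by
      filter_upwards [mem_nhdsWithin_of_mem_nhds (hnear e t), self_mem_nhdsWithin] with s hs hs'
      exact hs (ne_of_lt hs')
    obtain ⟨a, ha, ha'⟩ := mem_nhdsLT_iff_exists_Ioo_subset.1 h1
    have hm : max a 0 < t := max_lt ha ht.1
    obtain ⟨c, hc⟩ := haff e _ t (le_max_right a 0) ht.2 hm
      fun s hs => ha' ⟨(le_max_left _ _).trans_lt hs.1, hs.2⟩
    refine ⟨c, mem_of_superset (Icc_mem_nhdsLE hm) fun s hs => ?_⟩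
    have h2 := hc s hs
    have h3 := hc t ⟨hm.le, le_rfl⟩
    change f (Γ.param e s) = f (Γ.param e t) + c * (s - t)
    rw [h2, h3]
    ring
  choose! R hR using hR
  choose! S hS using hS
  exact ⟨R, S, hR, hS⟩

/-- The difference of two voltages has no kinks inside edges, so it is the interpolation of its
vertex values. These are harmonic at every vertex, hence orthogonal to all functions, in particular
of zero energy; so the difference is constant, and it vanishes at z. -/
theorem IsVoltage.unique (hΓ : Γ.IsMetrizedGraph) {z y : Γ.Point} {f₁ f₂ : Γ.Point → ℝ}
    (h₁ : Γ.IsVoltage z y f₁) (h₂ : Γ.IsVoltage z y f₂) : f₁ = f₂ := by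
  obtain ⟨R₁, S₁, hs₁⟩ := h₁.exists_hasSlopes
  obtain ⟨R₂, S₂, hs₂⟩ := h₂.exists_hasSlopes
  have hl := hΓ.2
  set d : Γ.Point → ℝ := fun x => f₁ x - f₂ x with hd
  have hs := hs₁.sub hs₂
  have h0 : ∀ x, Γ.slopeSum d x = 0 := by
    intro x
    rw [hd, hs₁.slopeSum_sub hl hs₂]
    linarith [h₁.kirchhoff x, h₂.kirchhoff x]
  have hdc : Continuous d := h₁.continuous.sub h₂.continuous
  have haff : ∀ e, ∃ c : ℝ, ∀ s ∈ Icc 0 (Γ.len e),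
      d (Γ.param e s) = d (Γ.param e 0) + c * (s - 0) := fun e => by
    refine affineOn_of_locally_affine (hl e) (hdc.comp (continuous_param e)).continuousOn
      fun t ht => hs.locally_affine ht ?_
    have := h0 (.interior e t ht)
    rw [hs.slopeSum_interior] at this
    linarith
  have hdi : d = interp (fun v => d (.vertex v)) := by
    ext x
    rcases x with v | ⟨e, t, ht⟩
    · rfl
    · obtain ⟨c, hc⟩ := haff e
      have h1 := hc t ⟨ht.1.le, ht.2.le⟩
      have h2 := hc (Γ.len e) ⟨(hl e).le, le_rfl⟩
      rw [param_of_mem ht, param_zero] at h1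
      rw [param_len (hl e), param_zero] at h2
      have := (hl e).ne'
      rw [h1]
      simp only [interp]
      rw [h2]
      field_simp
      ring
  have hE : ∀ F, Γ.energy (fun v => d (.vertex v)) F = 0 := by
    classical
    have := Fintype.ofFinite Γ.V
    intro F
    -- Orthogonality to the indicators of vertices, which is Kirchhoff's law, suffices by linearity.
    have hF : F = fun w => ∑ v, F v * (if w = v then 1 else 0) := by
      ext w; simp
    have h2 : ∀ v, Γ.energy (fun v => d (.vertex v)) (fun w => if w = v then 1 else 0) = 0 := by
      intro v
      have h3 := h0 (.vertex v)
      rw [hdi, slopeSum_interp_vertex hl] at h3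
      linarith
    calc Γ.energy (fun v => d (.vertex v)) F
        = ∑ v, F v * Γ.energy (fun v => d (.vertex v)) (fun w => if w = v then 1 else 0) := by
          simp only [energy, Finset.mul_sum]
          rw [Finset.sum_comm]
          refine Finset.sum_congr rfl fun e _ => ?_
          conv_lhs => rw [hF]
          simp only [← Finset.sum_sub_distrib, Finset.mul_sum, Finset.sum_div]
          refine Finset.sum_congr rfl fun v _ => ?_
          ring
      _ = 0 := by simp [h2]
  obtain ⟨v₀⟩ := hΓ.1.1
  have hconst : ∀ x, d x = d (.vertex v₀) := by
    intro x
    have h := hΓ.eq_of_energy_self_eq_zero (hE _)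
    rw [hdi]
    rcases x with v | ⟨e, t, ht⟩
    · exact h v v₀
    · simp only [interp]
      rw [h (Γ.tgt e) v₀, h (Γ.src e) v₀]
      ring
  ext x
  have h1 : d x = d z := by rw [hconst, hconst z]
  have h2 : d z = 0 := by simp [hd, h₁.ref_eq_zero, h₂.ref_eq_zero]
  have h3 : f₁ x - f₂ x = 0 := h1.trans h2
  linarith

theorem IsGreen.voltage_eq (hg : Γ.IsGreen o g) (hΓ : Γ.IsMetrizedGraph) (z x y : Γ.Point) :
    Γ.voltage z x y = kernelVoltage g z x y := by
  have h := hg.isVoltage hΓ.2 z y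
  exact congrFun (IsVoltage.unique hΓ (Classical.epsilon_spec ⟨_, h⟩) h) x

end LengthGraph

/-! ### Integration of bounded functions against signed measures -/

section SignedMeasure

theorem abs_intervalIntegral_le {X : Type*} {F : ℝ → X → ℝ} {C L : ℝ} (hL : 0 ≤ L) (hC : ∀ t x, |F t x| ≤ C) (x : X) :
    |∫ t in (0 : ℝ)..L, F t x| ≤ C * L := by
  have := intervalIntegral.norm_integral_le_of_norm_le_const (a := 0) (b := L)
    (f := fun t => F t x) (C := C) fun t _ => hC t x
  rwa [sub_zero, abs_of_nonneg hL] at this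

variable {X : Type*} [MeasurableSpace X]

theorem SignedMeasure.isFiniteMeasure_variation (ν : SignedMeasure X) :
    IsFiniteMeasure ν.variation := by
  rw [← ν.totalVariation_eq_variation]
  infer_instance

theorem SignedMeasure.integrable_of_bound (ν : SignedMeasure X) {f : X → ℝ} (hf : Measurable f)
    {C : ℝ} (hC : ∀ x, |f x| ≤ C) : ν.Integrable f := by
  have := SignedMeasure.isFiniteMeasure_variation ν
  exact Integrable.of_bound (μ := ν.variation) hf.aestronglyMeasurable C (Eventually.of_forall hC)

theorem SignedMeasure.integral_eq_sub (ν : SignedMeasure X) {f : X → ℝ} (hf : Measurable f)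
    {C : ℝ} (hC : ∀ x, |f x| ≤ C) :
    ∫ᵛ x, f x ∂<•ν = ∫ x, f x ∂ν.toJordanDecomposition.posPart -
      ∫ x, f x ∂ν.toJordanDecomposition.negPart := by
  conv_lhs => rw [← ν.toSignedMeasure_toJordanDecomposition, JordanDecomposition.toSignedMeasure]
  rw [VectorMeasure.integral_sub_vectorMeasure (SignedMeasure.integrable_of_bound _ hf hC)
    (SignedMeasure.integrable_of_bound _ hf hC), VectorMeasure.integral_toSignedMeasure,
    VectorMeasure.integral_toSignedMeasure]

variable {F : ℝ → X → ℝ} {C L : ℝ}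

theorem measurable_intervalIntegral (hL : 0 ≤ L) (hF : Measurable (Function.uncurry F)) :
    Measurable fun x => ∫ t in (0 : ℝ)..L, F t x := by
  simp only [intervalIntegral.integral_of_le hL]
  exact (hF.stronglyMeasurable.integral_prod_left (μ := volume.restrict (Ioc 0 L))).measurable

/-- Fubini's theorem for the two finite measures of the Jordan decomposition. -/
theorem SignedMeasure.integral_intervalIntegral_swap (ν : SignedMeasure X) (hL : 0 ≤ L)
    (hF : Measurable (Function.uncurry F)) (hC : ∀ t x, |F t x| ≤ C) :
    ∫ᵛ x, (∫ t in (0 : ℝ)..L, F t x) ∂<•ν = ∫ t in (0 : ℝ)..L, (∫ᵛ x, F t x ∂<•ν) := by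
  have hFt : ∀ t, Measurable (F t) := fun t => hF.comp measurable_prodMk_left
  have hint : ∀ m : Measure X, IsFiniteMeasure m →
      Integrable (Function.uncurry F) ((volume.restrict (Ioc 0 L)).prod m) := fun m _ =>
    Integrable.of_bound hF.aestronglyMeasurable C (Eventually.of_forall fun p => hC p.1 p.2)
  have hswap : ∀ m : Measure X, IsFiniteMeasure m →
      ∫ x, (∫ t in (0 : ℝ)..L, F t x) ∂m = ∫ t in (0 : ℝ)..L, (∫ x, F t x ∂m) := fun m _ => by
    simp only [intervalIntegral.integral_of_le hL]
    exact (integral_integral_swap (hint m inferInstance)).symm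
  have hI : ∀ m : Measure X, IsFiniteMeasure m →
      IntervalIntegrable (fun t => ∫ x, F t x ∂m) volume 0 L := fun m _ => by
    rw [intervalIntegrable_iff_integrableOn_Ioc_of_le hL]
    exact (hint m inferInstance).integral_prod_left
  rw [SignedMeasure.integral_eq_sub ν (measurable_intervalIntegral hL hF)
    (abs_intervalIntegral_le hL hC), hswap _ inferInstance, hswap _ inferInstance]
  simp only [SignedMeasure.integral_eq_sub ν (hFt _) (hC _)]
  rw [intervalIntegral.integral_sub (hI _ inferInstance) (hI _ inferInstance)]

end SignedMeasure

namespace LengthGraph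

variable {Γ : LengthGraph.{u}}

/-! ### Compactness and integrability of continuous functions -/

instance (Γ : LengthGraph.{u}) : CompactSpace Γ.Point := by
  have h : (univ : Set Γ.Point) =
      (⋃ v : Γ.V, {.vertex v}) ∪ ⋃ e : Γ.E, Γ.param e '' Icc 0 (Γ.len e) := by
    refine (eq_univ_of_forall fun x => ?_).symm
    rcases x with v | ⟨e, t, ht⟩
    · exact Or.inl (mem_iUnion.2 ⟨v, rfl⟩)
    · exact Or.inr (mem_iUnion.2 ⟨e, t, ⟨ht.1.le, ht.2.le⟩, param_of_mem ht⟩)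
  refine ⟨h ▸ (isCompact_iUnion fun v => isCompact_singleton).union
    (isCompact_iUnion fun e => isCompact_Icc.image (continuous_param e))⟩

theorem exists_bound_of_continuous {f : Γ.Point → ℝ} (hf : Continuous f) : ∃ C, ∀ x, |f x| ≤ C := by
  obtain ⟨C, hC⟩ := isCompact_univ.exists_bound_of_continuousOn hf.continuousOn
  exact ⟨C, fun x => hC x (mem_univ x)⟩

theorem integrable_of_continuous (ν : SignedMeasure Γ.Point) {f : Γ.Point → ℝ}
    (hf : Continuous f) : ν.Integrable f :=
  have ⟨_, hC⟩ := exists_bound_of_continuous hf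
  SignedMeasure.integrable_of_bound ν hf.measurable hC

/-! ### The canonical measure -/

/-- The density of the canonical measure on the edge `e`. -/
noncomputable def edgeDensity (g : Γ.V → Γ.V → ℝ) (e : Γ.E) : ℝ :=
  (Γ.len e - kernelRes g (Γ.src e) (Γ.tgt e)) / Γ.len e ^ 2

/-- Half the slope from one end of the edge `e` to the other of the diagonal of `g`. -/
noncomputable def diagSlope (g : Γ.V → Γ.V → ℝ) (e : Γ.E) : ℝ :=
  (g (Γ.tgt e) (Γ.tgt e) - g (Γ.src e) (Γ.src e)) / (2 * Γ.len e)

/-- Integration against the canonical measure. -/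
noncomputable def canonicalIntegral (o : Γ.V) (g : Γ.V → Γ.V → ℝ) (f : Γ.Point → ℝ) : ℝ :=
  f (.vertex o) + ∑ e : Γ.E,
    (diagSlope g e * (f (.vertex (Γ.tgt e)) - f (.vertex (Γ.src e))) +
      edgeDensity g e * ((∫ t in (0 : ℝ)..Γ.len e, f (Γ.param e t)) -
        Γ.len e / 2 * (f (.vertex (Γ.src e)) + f (.vertex (Γ.tgt e)))))

/-- The canonical measure. -/
noncomputable def canonicalMeasure (o : Γ.V) (g : Γ.V → Γ.V → ℝ) : SignedMeasure Γ.Point :=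
  VectorMeasure.dirac (.vertex o) 1 + ∑ e : Γ.E,
    (diagSlope g e • (VectorMeasure.dirac (.vertex (Γ.tgt e)) 1 -
        VectorMeasure.dirac (.vertex (Γ.src e)) 1) +
      edgeDensity g e •
        (((volume.restrict (Ioc 0 (Γ.len e))).map (Γ.param e)).toSignedMeasure -
          (Γ.len e / 2) • (VectorMeasure.dirac (.vertex (Γ.src e)) 1 +
            VectorMeasure.dirac (.vertex (Γ.tgt e)) 1)))

theorem integral_canonicalMeasure (hl : ∀ e, 0 < Γ.len e) (o : Γ.V) (g : Γ.V → Γ.V → ℝ)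
    {f : Γ.Point → ℝ} (hf : Continuous f) :
    ∫ᵛ x, f x ∂<•canonicalMeasure o g = canonicalIntegral o g f := by
  have hI := fun ν : SignedMeasure Γ.Point => integrable_of_continuous ν hf
  have hm := hf.measurable.stronglyMeasurable
  unfold canonicalMeasure canonicalIntegral
  rw [VectorMeasure.integral_add_vectorMeasure (hI _) (hI _),
    VectorMeasure.integral_finsetSum_vectorMeasure fun _ _ => hI _, VectorMeasure.integral_dirac' hm]
  congr 1
  · simp
  refine Finset.sum_congr rfl fun e _ => ?_
  rw [VectorMeasure.integral_add_vectorMeasure (hI _) (hI _),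
    VectorMeasure.integral_smul_vectorMeasure, VectorMeasure.integral_smul_vectorMeasure,
    VectorMeasure.integral_sub_vectorMeasure (hI _) (hI _),
    VectorMeasure.integral_sub_vectorMeasure (hI _) (hI _),
    VectorMeasure.integral_smul_vectorMeasure,
    VectorMeasure.integral_add_vectorMeasure (hI _) (hI _),
    VectorMeasure.integral_dirac' hm, VectorMeasure.integral_dirac' hm,
    VectorMeasure.integral_toSignedMeasure,
    integral_map (continuous_param e).measurable.aemeasurable hm.aestronglyMeasurable,
    intervalIntegral.integral_of_le (hl e).le]
  simp

theorem canonicalIntegral_const (o : Γ.V) (g : Γ.V → Γ.V → ℝ) (c : ℝ) :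
    canonicalIntegral o g (fun _ => c) = c := by
  simp only [canonicalIntegral, intervalIntegral.integral_const]
  rw [Finset.sum_eq_zero fun e _ => by simp; ring_nf; simp]
  simp

theorem canonicalMeasure_univ (hl : ∀ e, 0 < Γ.len e) (o : Γ.V) (g : Γ.V → Γ.V → ℝ) :
    canonicalMeasure o g univ = 1 := by
  have h1 := integral_canonicalMeasure hl o g (f := fun _ => 1) continuous_const
  have := SignedMeasure.isFiniteMeasure_variation (canonicalMeasure o g)
  rw [canonicalIntegral_const, VectorMeasure.integral_const] at h1
  simpa using h1

theorem canonicalIntegral_add (o : Γ.V) (g : Γ.V → Γ.V → ℝ) {f f' : Γ.Point → ℝ}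
    (hf : Continuous f) (hf' : Continuous f') :
    canonicalIntegral o g (fun x => f x + f' x) =
      canonicalIntegral o g f + canonicalIntegral o g f' := by
  unfold canonicalIntegral
  have : ∀ e, ∫ t in (0 : ℝ)..Γ.len e, (f (Γ.param e t) + f' (Γ.param e t)) =
      (∫ t in (0 : ℝ)..Γ.len e, f (Γ.param e t)) + ∫ t in (0 : ℝ)..Γ.len e, f' (Γ.param e t) :=
    fun e => intervalIntegral.integral_add
      ((hf.comp (continuous_param e)).intervalIntegrable _ _)
      ((hf'.comp (continuous_param e)).intervalIntegrable _ _)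
  simp only [this]
  rw [add_add_add_comm, ← Finset.sum_add_distrib]
  congr 1
  exact Finset.sum_congr rfl fun e _ => by ring

theorem canonicalIntegral_smul (o : Γ.V) (g : Γ.V → Γ.V → ℝ) (c : ℝ) (f : Γ.Point → ℝ) :
    canonicalIntegral o g (fun x => c * f x) = c * canonicalIntegral o g f := by
  simp only [canonicalIntegral, intervalIntegral.integral_const_mul, mul_add, Finset.mul_sum]
  congr 1
  exact Finset.sum_congr rfl fun e _ => by ring

/-! ### The tau constant in terms of a Green function -/

/-- The function vanishing at the vertices with second derivative `-2 c e` on the edge `e`. -/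
noncomputable def hat (c : Γ.E → ℝ) : Γ.Point → ℝ
  | .vertex _ => 0
  | .interior e t _ => c e * (t * (Γ.len e - t))

theorem hat_vertex (c : Γ.E → ℝ) (v : Γ.V) : hat c (.vertex v) = 0 := rfl

theorem hat_param {e : Γ.E} (he : 0 < Γ.len e) (c : Γ.E → ℝ) (s : ℝ) :
    hat c (Γ.param e s) = c e * (Γ.clamp e s * (Γ.len e - Γ.clamp e s)) := by
  unfold param
  split_ifs with h1 h2
  · rw [clamp_of_mem ⟨h1.1.le, h1.2.le⟩]; rfl
  · rw [clamp, max_eq_left ((min_le_left _ _).trans h2)]; simp [hat]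
  · have : Γ.len e ≤ s := by
      by_contra h; exact h1 ⟨not_le.1 h2, not_le.1 h⟩
    rw [clamp, min_eq_right this, max_eq_right he.le]; simp [hat]

theorem continuous_hat (hl : ∀ e, 0 < Γ.len e) (c : Γ.E → ℝ) : Continuous (hat c) := by
  rw [continuous_iff_forall_edge]
  intro e
  simp only [hat_param (hl e)]
  have := continuous_clamp e
  fun_prop

theorem integral_interp_param {e : Γ.E} (he : 0 < Γ.len e) (u : Γ.V → ℝ) :
    ∫ t in (0 : ℝ)..Γ.len e, interp u (Γ.param e t) =
      Γ.len e / 2 * (u (Γ.src e) + u (Γ.tgt e)) := by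
  have h : ∫ t in (0 : ℝ)..Γ.len e, interp u (Γ.param e t) = ∫ t in (0 : ℝ)..Γ.len e,
      (u (Γ.src e) + (u (Γ.tgt e) - u (Γ.src e)) / Γ.len e * t) :=
    intervalIntegral.integral_congr fun t ht => by
      rw [uIcc_of_le he.le] at ht
      simp only [interp_param he, clamp_of_mem ht]
      ring
  rw [h, intervalIntegral.integral_add (by simp) (Continuous.intervalIntegrable (by fun_prop) _ _),
    intervalIntegral.integral_const, intervalIntegral.integral_const_mul, integral_id]
  have := he.ne'
  simp only [sub_zero, smul_eq_mul]
  field_simp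
  ring

theorem integral_hat_param {e : Γ.E} (he : 0 < Γ.len e) (c : Γ.E → ℝ) :
    ∫ t in (0 : ℝ)..Γ.len e, hat c (Γ.param e t) = c e * Γ.len e ^ 3 / 6 := by
  have h : ∫ t in (0 : ℝ)..Γ.len e, hat c (Γ.param e t) = ∫ t in (0 : ℝ)..Γ.len e,
      (c e * Γ.len e * t - c e * t ^ 2) :=
    intervalIntegral.integral_congr fun t ht => by
      rw [uIcc_of_le he.le] at ht
      simp only [hat_param he, clamp_of_mem ht]
      ring
  rw [h, intervalIntegral.integral_sub (Continuous.intervalIntegrable (by fun_prop) _ _)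
    (Continuous.intervalIntegrable (by fun_prop) _ _),
    intervalIntegral.integral_const_mul, intervalIntegral.integral_const_mul, integral_id,
    integral_pow]
  norm_num
  ring

theorem integral_tent_interior {e : Γ.E} {t : ℝ} (ht : t ∈ Ioo 0 (Γ.len e)) :
    ∫ s in (0 : ℝ)..Γ.len e, tent e (.interior e t ht) s = t * (Γ.len e - t) / 2 := by
  have hc := continuous_tent e (.interior e t ht)
  rw [← intervalIntegral.integral_add_adjacent_intervals (b := t) (hc.intervalIntegrable _ _)
    (hc.intervalIntegrable _ _)]
  have h1 : ∫ s in (0 : ℝ)..t, tent e (.interior e t ht) s =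
      ∫ s in (0 : ℝ)..t, (1 - t / Γ.len e) * s :=
    intervalIntegral.integral_congr fun s hs => by
      rw [uIcc_of_le ht.1.le] at hs
      simp only [tent, if_true, min_eq_left hs.2]
      ring
  have h2 : ∫ s in t..Γ.len e, tent e (.interior e t ht) s =
      ∫ s in t..Γ.len e, (t - t / Γ.len e * s) :=
    intervalIntegral.integral_congr fun s hs => by
      rw [uIcc_of_le ht.2.le] at hs
      simp only [tent, if_true, min_eq_right hs.1]
      ring
  rw [h1, h2, intervalIntegral.integral_sub (by simp)
    (Continuous.intervalIntegrable (by fun_prop) _ _), intervalIntegral.integral_const_mul,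
    intervalIntegral.integral_const_mul, integral_id, integral_id, intervalIntegral.integral_const]
  have := (ht.1.trans ht.2).ne'
  simp only [smul_eq_mul]
  field_simp
  ring

/-- The tent is the Dirichlet Green function of the edge and `hat c` has second derivative -2c with
zero boundary values, so integrating c against the tent gives half of `hat c`. -/
theorem sum_mul_integral_tent (c : Γ.E → ℝ) (y : Γ.Point) :
    ∑ e, c e * ∫ s in (0 : ℝ)..Γ.len e, tent e y s = hat c y / 2 := by
  rcases y with v | ⟨e, t, ht⟩
  · simp [tent, hat]
  · rw [Finset.sum_eq_single e, integral_tent_interior ht, hat]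
    · ring
    · intro e' _ he
      simp [tent, he.symm]
    · simp

/-- The density terms drop out because the trapezoidal rule is exact for affine functions; the slope
terms add up to half an energy. -/
theorem canonicalIntegral_interp (hl : ∀ e, 0 < Γ.len e) (o : Γ.V) (g : Γ.V → Γ.V → ℝ)
    (u : Γ.V → ℝ) :
    canonicalIntegral o g (interp u) = u o + Γ.energy (fun v => g v v) u / 2 := by
  unfold canonicalIntegral energy
  rw [Finset.sum_div]
  congr 1
  refine Finset.sum_congr rfl fun e _ => ?_
  rw [integral_interp_param (hl e)]
  have := (hl e).ne'
  simp only [interp, diagSlope]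
  field_simp
  ring

theorem bump_vertex (v : Γ.V) (y : Γ.Point) : bump (.vertex v) y = 0 := rfl

theorem canonicalIntegral_bump (hl : ∀ e, 0 < Γ.len e) (o : Γ.V) (g : Γ.V → Γ.V → ℝ)
    (y : Γ.Point) :
    canonicalIntegral o g (fun x => bump x y) = hat (edgeDensity g) y / 2 := by
  unfold canonicalIntegral
  rw [← sum_mul_integral_tent]
  simp only [bump_vertex, sub_zero, mul_zero, add_zero, zero_add]
  refine Finset.sum_congr rfl fun e _ => ?_
  congr 1
  refine intervalIntegral.integral_congr fun t ht => ?_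
  rw [uIcc_of_le (hl e).le] at ht
  simp only [bump_param (hl e), clamp_of_mem ht]

theorem canonicalIntegral_hat (hl : ∀ e, 0 < Γ.len e) (o : Γ.V) (g : Γ.V → Γ.V → ℝ) :
    canonicalIntegral o g (hat (edgeDensity g)) =
      ∑ e, (Γ.len e - kernelRes g (Γ.src e) (Γ.tgt e)) ^ 2 / (6 * Γ.len e) := by
  unfold canonicalIntegral
  simp only [hat_vertex, zero_add, sub_zero, mul_zero, add_zero]
  refine Finset.sum_congr rfl fun e _ => ?_
  rw [integral_hat_param (hl e)]
  have := (hl e).ne'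
  simp only [edgeDensity]
  field_simp

variable {o : Γ.V} {g : Γ.V → Γ.V → ℝ}

/-- Along an edge, double interpolation on the diagonal exceeds linear interpolation by -r
t(L-t)/L², and the tent contributes t(L-t)/L. Together they give the coefficient (L-r)/L², which is
`edgeDensity`. -/
theorem IsGreen.kernel_diag (hg : Γ.IsGreen o g) (hl : ∀ e, 0 < Γ.len e) (x : Γ.Point) :
    kernel g x x = interp (fun v => g v v) x + hat (edgeDensity g) x := by
  rcases x with v | ⟨e, t, ht⟩
  · simp [kernel, interp, bump, hat]
  · simp only [kernel, interp, bump, tent, hat, edgeDensity, kernelRes, if_true, min_self,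
      hg.symm (Γ.tgt e) (Γ.src e)]
    have := (hl e).ne'
    field_simp
    ring

/-- The functional is evaluation at `o` plus half the pairing with the Laplacian of the diagonal.
Moving the Laplacian onto k(·,y) returns half of k(y,y), since k vanishes when one argument is `o`.
-/
theorem IsGreen.canonicalIntegral_kernel (hg : Γ.IsGreen o g) (hl : ∀ e, 0 < Γ.len e)
    (y : Γ.Point) : canonicalIntegral o g (fun x => kernel g x y) = kernel g y y / 2 := by
  unfold kernel
  rw [canonicalIntegral_add o g (continuous_interp hl _) (continuous_bump hl y),
    canonicalIntegral_interp hl, canonicalIntegral_bump hl, energy_comm, hg.energy_interp,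
    hg.ground]
  have h0 : interp (g o) y = 0 := by
    rcases y with v | ⟨e, t, ht⟩ <;> simp [interp, hg.ground]
  have h1 := hg.kernel_diag hl y
  rw [kernel] at h1
  rw [h0, h1]
  ring

/-- The expression of the tau constant by a Green function on the vertices. -/
noncomputable def tauSum (g : Γ.V → Γ.V → ℝ) : ℝ :=
  1 / 4 * ∑ e : Γ.E, ((g (Γ.tgt e) (Γ.tgt e) - g (Γ.src e) (Γ.src e)) ^ 2 / Γ.len e +
    (Γ.len e - kernelRes g (Γ.src e) (Γ.tgt e)) ^ 2 / (3 * Γ.len e))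

theorem continuous_kernel_diag (hg : Γ.IsGreen o g) (hl : ∀ e, 0 < Γ.len e) :
    Continuous fun x => kernel g x x := by
  simp only [hg.kernel_diag hl]
  exact (continuous_interp hl _).add (continuous_hat hl _)

/-- The value is half the Dirichlet energy of the diagonal, to which the interpolated part and the
hat contribute without a cross term. -/
theorem IsGreen.canonicalIntegral_diag (hg : Γ.IsGreen o g) (hl : ∀ e, 0 < Γ.len e) :
    canonicalIntegral o g (fun x => kernel g x x) = 2 * tauSum g := by
  simp only [hg.kernel_diag hl]
  rw [canonicalIntegral_add o g (continuous_interp hl _) (continuous_hat hl _),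
    canonicalIntegral_interp hl, canonicalIntegral_hat hl, hg.ground, energy, tauSum, zero_add,
    Finset.sum_div, ← Finset.sum_add_distrib, Finset.mul_sum, Finset.mul_sum]
  refine Finset.sum_congr rfl fun e _ => ?_
  have := (hl e).ne'
  field_simp
  ring

theorem IsGreen.kernelVoltage_diag (hg : Γ.IsGreen o g) (z x : Γ.Point) :
    kernelVoltage g z x x = kernel g x x + (kernel g z z + (-2) * kernel g z x) := by
  rw [kernelVoltage, hg.kernel_comm x z]
  ring

theorem IsGreen.continuous_kernelVoltage (hg : Γ.IsGreen o g) (hl : ∀ e, 0 < Γ.len e)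
    (x : Γ.Point) : Continuous fun z => kernelVoltage g z x x := by
  simp only [hg.kernelVoltage_diag]
  exact continuous_const.add ((continuous_kernel_diag hg hl).add
    (continuous_const.mul (continuous_kernel hl g x)))

/-- In k(x,x) + k(z,z) - 2k(z,x), the last term integrates to -k(x,x) and cancels the first, so x
disappears. -/
theorem IsGreen.canonicalIntegral_voltage (hg : Γ.IsGreen o g) (hl : ∀ e, 0 < Γ.len e)
    (x : Γ.Point) : canonicalIntegral o g (fun z => kernelVoltage g z x x) = 2 * tauSum g := by
  have h1 : Continuous fun z => -2 * kernel g z x := continuous_const.mul (continuous_kernel hl g x)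
  have h2 : Continuous fun z => kernel g z z + -2 * kernel g z x :=
    (continuous_kernel_diag hg hl).add h1
  simp only [hg.kernelVoltage_diag]
  rw [canonicalIntegral_add o g continuous_const h2,
    canonicalIntegral_add o g (continuous_kernel_diag hg hl) h1, canonicalIntegral_const,
    canonicalIntegral_smul, hg.canonicalIntegral_kernel hl, hg.canonicalIntegral_diag hl]
  ring

/-! ### Uniform bounds, Fubini's theorem and the value of the tau constant -/

theorem abs_interp_le (hl : ∀ e, 0 < Γ.len e) {u : Γ.V → ℝ} {B : ℝ} (hu : ∀ v, |u v| ≤ B)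
    (x : Γ.Point) : |interp u x| ≤ B := by
  rcases x with v | ⟨e, t, ht⟩
  · exact hu v
  · have h0 : 0 ≤ t / Γ.len e := div_nonneg ht.1.le (hl e).le
    have h1 : t / Γ.len e ≤ 1 := (div_le_one (hl e)).2 ht.2.le
    have ha := abs_le.1 (hu (Γ.src e))
    have hb := abs_le.1 (hu (Γ.tgt e))
    simp only [interp]
    rw [abs_le]
    constructor <;> nlinarith

theorem abs_bump_le (hl : ∀ e, 0 < Γ.len e) (x y : Γ.Point) : |bump x y| ≤ Γ.totalLength := by
  have h0 : 0 ≤ Γ.totalLength := Finset.sum_nonneg fun e _ => (hl e).le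
  rcases x with v | ⟨e, s, hs⟩
  · simpa [bump] using h0
  · rcases y with w | ⟨e', t, ht⟩
    · simpa [bump, tent] using h0
    · simp only [bump, tent]
      split_ifs with he
      · subst he
        have h1 : Γ.len e' ≤ Γ.totalLength :=
          Finset.single_le_sum (f := Γ.len) (fun e _ => (hl e).le) (Finset.mem_univ e')
        have h2 : 0 ≤ s * t / Γ.len e' := div_nonneg (mul_nonneg hs.1.le ht.1.le) (hl e').le
        have h3 : s * t / Γ.len e' ≤ Γ.len e' := by
          rw [div_le_iff₀ (hl e')]
          exact mul_le_mul hs.2.le ht.2.le ht.1.le (hl e').le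
        have h4 : 0 ≤ min s t := le_min hs.1.le ht.1.le
        have h5 : min s t ≤ Γ.len e' := (min_le_left _ _).trans hs.2.le
        rw [abs_le]
        constructor <;> linarith
      · simpa using h0

theorem exists_bound_kernelVoltage (hl : ∀ e, 0 < Γ.len e) (g : Γ.V → Γ.V → ℝ) :
    ∃ C, ∀ z x, |kernelVoltage g z x x| ≤ C := by
  obtain ⟨B, hB⟩ := (Set.finite_range fun p : Γ.V × Γ.V => |g p.1 p.2|).bddAbove
  have hk : ∀ x y, |kernel g x y| ≤ B + Γ.totalLength := fun x y =>
    (abs_add_le _ _).trans (add_le_add (abs_interp_le hl (fun v => abs_interp_le hl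
      (fun w => hB ⟨(v, w), rfl⟩) y) x) (abs_bump_le hl x y))
  refine ⟨4 * (B + Γ.totalLength), fun z x => ?_⟩
  have h1 := abs_le.1 (hk x x)
  have h2 := abs_le.1 (hk x z)
  have h3 := abs_le.1 (hk z z)
  have h4 := abs_le.1 (hk z x)
  rw [kernelVoltage, abs_le]
  constructor <;> linarith

theorem kernelVoltage_diag_comm (g : Γ.V → Γ.V → ℝ) (z x : Γ.Point) :
    kernelVoltage g z x x = kernelVoltage g x z z := by
  rw [kernelVoltage, kernelVoltage]
  ring

/-- Fubini's theorem for the canonical measure and another signed measure. -/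
theorem IsGreen.integral_canonicalIntegral (hg : Γ.IsGreen o g) (hl : ∀ e, 0 < Γ.len e)
    (ν : SignedMeasure Γ.Point) :
    ∫ᵛ x, canonicalIntegral o g (fun z => kernelVoltage g z x x) ∂<•ν =
      canonicalIntegral o g (fun z => ∫ᵛ x, kernelVoltage g z x x ∂<•ν) := by
  obtain ⟨C, hC⟩ := exists_bound_kernelVoltage hl g
  have hc : ∀ z, Continuous fun x => kernelVoltage g z x x := fun z => by
    simp only [kernelVoltage_diag_comm g z]
    exact hg.continuous_kernelVoltage hl z
  have hI : ∀ z, ν.Integrable fun x => kernelVoltage g z x x :=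
    fun z => integrable_of_continuous ν (hc z)
  -- Joint measurability follows from continuity in the edge coordinate and measurability in x
  -- separately.
  have hF : ∀ e : Γ.E, Measurable
      (Function.uncurry fun t x => kernelVoltage g (Γ.param e t) x x) := fun e =>
    measurable_uncurry_of_continuous_of_measurable
      (fun x => (hg.continuous_kernelVoltage hl x).comp (continuous_param e))
      (fun t => (hc _).measurable)
  have hJ : ∀ e : Γ.E,
      ν.Integrable fun x => ∫ t in (0 : ℝ)..Γ.len e, kernelVoltage g (Γ.param e t) x x :=
    fun e => SignedMeasure.integrable_of_bound ν (measurable_intervalIntegral (hl e).le (hF e))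
      (abs_intervalIntegral_le (hl e).le fun t x => hC _ x)
  simp only [canonicalIntegral]
  have h1 : ∀ e : Γ.E, ν.Integrable fun x => diagSlope g e *
      (kernelVoltage g (.vertex (Γ.tgt e)) x x - kernelVoltage g (.vertex (Γ.src e)) x x) :=
    fun e => ((hI _).sub (hI _)).const_mul _
  have h2 : ∀ e : Γ.E, ν.Integrable fun x => Γ.len e / 2 *
      (kernelVoltage g (.vertex (Γ.src e)) x x + kernelVoltage g (.vertex (Γ.tgt e)) x x) :=
    fun e => ((hI _).add (hI _)).const_mul _
  have h3 : ∀ e : Γ.E, ν.Integrable fun x => edgeDensity g e *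
      ((∫ t in (0 : ℝ)..Γ.len e, kernelVoltage g (Γ.param e t) x x) - Γ.len e / 2 *
        (kernelVoltage g (.vertex (Γ.src e)) x x + kernelVoltage g (.vertex (Γ.tgt e)) x x)) :=
    fun e => ((hJ e).sub (h2 e)).const_mul _
  have hmul : ∀ (c : ℝ) (f : Γ.Point → ℝ), ∫ᵛ x, c * f x ∂<•ν = c * ∫ᵛ x, f x ∂<•ν :=
    fun _ _ => VectorMeasure.integral_fun_smul ..
  rw [VectorMeasure.integral_fun_add (hI _)
    (VectorMeasure.Integrable.fun_finsetSum _ fun e _ => (h1 e).fun_add (h3 e)),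
    VectorMeasure.integral_finsetSum _ fun e _ => (h1 e).fun_add (h3 e)]
  congr 1
  refine Finset.sum_congr rfl fun e _ => ?_
  rw [VectorMeasure.integral_fun_add (h1 e) (h3 e), hmul, hmul,
    VectorMeasure.integral_fun_sub (hI _) (hI _), VectorMeasure.integral_fun_sub (hJ e) (h2 e),
    hmul, VectorMeasure.integral_fun_add (hI _) (hI _),
    SignedMeasure.integral_intervalIntegral_swap ν (hl e).le (hF e) fun t x => hC _ x]

/-- Since `tau` is a choice, every admissible measure ν must yield the same constant. The resistance
is symmetric, so integrating it against ν and the canonical measure in the two orders gives 2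
`tauSum g` and 2 `tau`, both measures having mass one. -/
theorem IsGreen.tau_eq (hg : Γ.IsGreen o g) (hΓ : Γ.IsMetrizedGraph) : Γ.tau = tauSum g := by
  have hl := hΓ.2
  have hvm : ∀ ν x, Γ.voltageMeasure ν x x = ∫ᵛ z, kernelVoltage g z x x ∂<•ν := fun ν x => by
    simp only [voltageMeasure, hg.voltage_eq hΓ]
  have hcan : ∀ x, Γ.voltageMeasure (canonicalMeasure o g) x x = 2 * tauSum g := fun x => by
    rw [hvm, integral_canonicalMeasure hl o g (hg.continuous_kernelVoltage hl x),
      hg.canonicalIntegral_voltage hl]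
  have hex : ∃ t : ℝ, ∃ μ : SignedMeasure Γ.Point,
      Γ.IsCanonicalMeasure μ ∧ ∀ x : Γ.Point, (1 / 2) * Γ.voltageMeasure μ x x = t :=
    ⟨tauSum g, canonicalMeasure o g, ⟨canonicalMeasure_univ hl o g, _, hcan⟩, fun x => by
      rw [hcan]; ring⟩
  obtain ⟨ν, ⟨hν, -⟩, hν'⟩ := Classical.epsilon_spec hex
  change ∀ x, 1 / 2 * Γ.voltageMeasure ν x x = Γ.tau at hν'
  have h1 : ∀ z, ∫ᵛ x, kernelVoltage g z x x ∂<•ν = 2 * Γ.tau := fun z => by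
    rw [← hν' z, hvm]
    simp only [kernelVoltage_diag_comm g z]
    ring
  have h2 := hg.integral_canonicalIntegral hl ν
  have := SignedMeasure.isFiniteMeasure_variation ν
  simp only [hg.canonicalIntegral_voltage hl, h1, canonicalIntegral_const,
    VectorMeasure.integral_const, hν] at h2
  simp at h2
  linarith

end LengthGraph

namespace LengthGraph

variable {Γ : LengthGraph.{u}} {o : Γ.V} {g : Γ.V → Γ.V → ℝ}

/-! ### Resistances and the constant `A` in terms of a Green function -/

theorem IsGreen.resistance_vertex (hg : Γ.IsGreen o g) (hΓ : Γ.IsMetrizedGraph) (x y : Γ.V) :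
    Γ.resistance (.vertex x) (.vertex y) = kernelRes g x y := by
  rw [resistance, hg.voltage_eq hΓ]
  simp only [kernelVoltage, kernel, interp, bump, kernelRes, hg.symm y x]
  ring

theorem IsGreen.kernelRes_ground (hg : Γ.IsGreen o g) (y : Γ.V) : kernelRes g o y = g y y := by
  rw [kernelRes, hg.ground, hg.ground]
  ring

theorem IsGreen.kernel_ground (hg : Γ.IsGreen o g) (y : Γ.Point) : kernel g (.vertex o) y = 0 := by
  rcases y with v | ⟨e, t, ht⟩ <;> simp [kernel, interp, bump, hg.ground]

theorem kernel_vertex_right (g : Γ.V → Γ.V → ℝ) (x : Γ.Point) (q : Γ.V) :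
    kernel g x (.vertex q) = interp (fun v => g v q) x := by
  rcases x with v | ⟨e, t, ht⟩ <;> simp [kernel, interp, bump, tent]

theorem deriv_interp_param {e : Γ.E} (he : 0 < Γ.len e) (u : Γ.V → ℝ) {t : ℝ}
    (ht : t ∈ Ioo 0 (Γ.len e)) :
    deriv (fun s => interp u (Γ.param e s)) t = (u (Γ.tgt e) - u (Γ.src e)) / Γ.len e := by
  have h : (fun s => interp u (Γ.param e s)) =ᶠ[𝓝 t]
      fun s => u (Γ.src e) + (u (Γ.tgt e) - u (Γ.src e)) * (s / Γ.len e) := by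
    filter_upwards [Ioo_mem_nhds ht.1 ht.2] with s hs
    rw [interp_param he, clamp_of_mem ⟨hs.1.le, hs.2.le⟩]
  rw [h.deriv_eq]
  have := (((hasDerivAt_id' t).div_const (Γ.len e)).const_mul
    (u (Γ.tgt e) - u (Γ.src e))).const_add (u (Γ.src e))
  rw [HasDerivAt.deriv this]
  ring

/-- The constant `A` as a finite sum over the edges. -/
theorem IsGreen.A_eq (hg : Γ.IsGreen o g) (hΓ : Γ.IsMetrizedGraph) (q : Γ.V) :
    Γ.A (.vertex o) (.vertex q) =
      ∑ e : Γ.E, (g (Γ.tgt e) q - g (Γ.src e) q) ^ 2 / Γ.len e *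
        ((g (Γ.src e) (Γ.src e) - g (Γ.src e) q + (g (Γ.tgt e) (Γ.tgt e) - g (Γ.tgt e) q)) / 2 +
          (Γ.len e - kernelRes g (Γ.src e) (Γ.tgt e)) / 6) := by
  have hl := hΓ.2
  have h1 : ∀ x, Γ.voltage x (.vertex o) (.vertex q) =
      interp (fun v => g v v) x + hat (edgeDensity g) x - interp (fun v => g v q) x := fun x => by
    rw [hg.voltage_eq hΓ, kernelVoltage, hg.kernel_ground, hg.kernel_ground, ← hg.kernel_diag hl,
      kernel_vertex_right]
    ring
  have h2 : ∀ x, Γ.voltage (.vertex o) x (.vertex q) = interp (fun v => g v q) x := fun x => by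
    rw [hg.voltage_eq hΓ, kernelVoltage, hg.kernel_ground, hg.kernel_ground, hg.kernel_comm x,
      hg.kernel_comm x, hg.kernel_ground, hg.kernel_comm, kernel_vertex_right]
    ring
  unfold A edgeIntegral
  refine Finset.sum_congr rfl fun e _ => ?_
  simp only [h1, h2]
  -- The derivative is known only inside the edge: at the ends the constant extension of `param` may
  -- create a kink. The open interval suffices for the integral.
  have h3 : ∫ t in (0 : ℝ)..Γ.len e,
      (interp (fun v => g v v) (Γ.param e t) + hat (edgeDensity g) (Γ.param e t) -
        interp (fun v => g v q) (Γ.param e t)) *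
        deriv (fun s => interp (fun v => g v q) (Γ.param e s)) t ^ 2 =
      ∫ t in (0 : ℝ)..Γ.len e,
      (interp (fun v => g v v) (Γ.param e t) + hat (edgeDensity g) (Γ.param e t) -
        interp (fun v => g v q) (Γ.param e t)) *
        ((g (Γ.tgt e) q - g (Γ.src e) q) / Γ.len e) ^ 2 := by
    exact intervalIntegral.integral_congr_Ioo_of_le (hl e).le fun t ht => by
      simp only [deriv_interp_param (hl e) _ ht]
  have hi : ∀ u : Γ.V → ℝ, IntervalIntegrable (fun t => interp u (Γ.param e t)) volume 0
      (Γ.len e) := fun u =>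
    ((continuous_interp hl u).comp (continuous_param e)).intervalIntegrable _ _
  have hh : IntervalIntegrable (fun t => hat (edgeDensity g) (Γ.param e t)) volume 0 (Γ.len e) :=
    ((continuous_hat hl _).comp (continuous_param e)).intervalIntegrable _ _
  rw [h3, intervalIntegral.integral_mul_const, intervalIntegral.integral_sub ((hi _).add hh) (hi _),
    intervalIntegral.integral_add (hi _) hh, integral_interp_param (hl e),
    integral_interp_param (hl e), integral_hat_param (hl e), edgeDensity]
  have := (hl e).ne'
  field_simp
  ring

/-! ### The resistance of an edge -/

open Classical in
theorem energy_eq_add_deleteEdge (e : Γ.E) (F H : Γ.V → ℝ) :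
    Γ.energy F H = (F (Γ.tgt e) - F (Γ.src e)) * (H (Γ.tgt e) - H (Γ.src e)) / Γ.len e +
      (Γ.deleteEdge e).energy F H := by
  unfold energy
  rw [← Finset.add_sum_erase _ _ (Finset.mem_univ e)]
  congr 1
  exact Finset.sum_subtype (p := fun e' => e' ≠ e) _ (by simp)
    (fun e' => (F (Γ.tgt e') - F (Γ.src e')) * (H (Γ.tgt e') - H (Γ.src e')) / Γ.len e')

theorem connected_deleteEdge (hΓ : Γ.Connected) (e : Γ.E)
    (h : Relation.EqvGen (fun a b => ∃ e' : (Γ.deleteEdge e).E,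
      (Γ.deleteEdge e).src e' = a ∧ (Γ.deleteEdge e).tgt e' = b) (Γ.src e) (Γ.tgt e)) :
    (Γ.deleteEdge e).Connected := by
  refine ⟨hΓ.1, fun u v => ?_⟩
  induction hΓ.2 u v with
  | rel x y hxy =>
    obtain ⟨e', rfl, rfl⟩ := hxy
    by_cases he : e' = e
    · subst he; exact h
    · exact Relation.EqvGen.rel _ _ ⟨⟨e', he⟩, rfl, rfl⟩
  | refl x => exact Relation.EqvGen.refl _
  | symm x y _ ih => exact Relation.EqvGen.symm _ _ ih
  | trans x y z _ _ ih₁ ih₂ => exact Relation.EqvGen.trans _ _ _ ih₁ ih₂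

theorem invLenAddRes_of_connected {e : Γ.E} (he : 0 < Γ.len e) (hc : (Γ.deleteEdge e).Connected)
    {R : ℝ} (hR : 0 ≤ R)
    (h : (Γ.deleteEdge e).resistance (.vertex (Γ.src e)) (.vertex (Γ.tgt e)) = R) :
    Γ.invLenAddRes e = (Γ.len e + R)⁻¹ := by
  have h1 : Γ.edgeResistance e = ENNReal.ofReal R := by
    unfold edgeResistance
    rw [if_pos hc]
    exact congrArg _ h
  rw [invLenAddRes, h1, ← ENNReal.ofReal_add he.le hR, ← ENNReal.ofReal_inv_of_pos (by linarith),
    ENNReal.toReal_ofReal (by positivity)]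

theorem invLenAddRes_of_not_connected {e : Γ.E} (hc : ¬ (Γ.deleteEdge e).Connected) :
    Γ.invLenAddRes e = 0 := by
  have h1 : Γ.edgeResistance e = ∞ := by
    unfold edgeResistance
    rw [if_neg hc]
  simp [invLenAddRes, h1]

/-- `L² / (L + R)` is the length of an edge minus the resistance between its end points. -/
theorem IsGreen.len_sq_mul_invLenAddRes (hg : Γ.IsGreen o g) (hΓ : Γ.IsMetrizedGraph) (e : Γ.E) :
    Γ.len e ^ 2 * Γ.invLenAddRes e = Γ.len e - kernelRes g (Γ.src e) (Γ.tgt e) := by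
  rw [← hg.resistance_vertex hΓ]
  obtain ⟨k, hk⟩ := hΓ.exists_isGreen (Γ.src e)
  rw [hk.resistance_vertex hΓ, hk.kernelRes_ground]
  have hL := hΓ.2 e
  -- The reproducing identity with pole at the final end, with the energy split into the term of e
  -- and the energy on Γ - e. As k is grounded at the initial end, k(tgt,tgt) is the resistance r.
  have hsplit := fun F => (hk.energy_eq (Γ.tgt e) F).symm.trans
    (energy_eq_add_deleteEdge e (fun v => k v (Γ.tgt e)) F)
  simp only [hk.ground, sub_zero] at hsplit
  by_cases hc : (Γ.deleteEdge e).Connected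
  · have hD : (Γ.deleteEdge e).IsMetrizedGraph := ⟨hc, fun e' => hΓ.2 e'.1⟩
    obtain ⟨k', hk'⟩ := hD.exists_isGreen (Γ.src e)
    obtain ⟨R, hR⟩ : ∃ R : ℝ, k' (Γ.tgt e) (Γ.tgt e) = R := ⟨_, rfl⟩
    have hR0 : 0 ≤ R := hR ▸ hk'.diag_nonneg hD.2 (Γ.tgt e)
    have hres : (Γ.deleteEdge e).resistance (.vertex (Γ.src e)) (.vertex (Γ.tgt e)) = R :=
      (hk'.resistance_vertex hD _ _).trans ((hk'.kernelRes_ground _).trans hR)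
    have hE : (Γ.deleteEdge e).energy (fun v => k v (Γ.tgt e)) (fun v => k' v (Γ.tgt e)) =
        k (Γ.tgt e) (Γ.tgt e) - k (Γ.src e) (Γ.tgt e) :=
      (energy_comm _ _).trans (hk'.energy_eq (Γ.tgt e) (fun v => k v (Γ.tgt e)))
    have h0 : k' (Γ.src e) (Γ.tgt e) = 0 := hk'.ground _
    -- Testing against the Green function of Γ - e gives R = rR/L + r, that is, r = LR/(L+R).
    have h1 := (hsplit fun v => k' v (Γ.tgt e)).trans (congrArg (_ + ·) hE)
    simp only [hk.ground, h0, hR, sub_zero] at h1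
    rw [invLenAddRes_of_connected hL hc hR0 hres]
    have h3 : Γ.len e + R ≠ 0 := by linarith
    field_simp at h1 ⊢
    linarith
  · rw [invLenAddRes_of_not_connected hc, mul_zero]
    classical
    -- For a bridge, the test function is the indicator of the vertices not joined to the initial
    -- end in Γ - e. It is constant along every remaining edge, so the identity reads 1 = r/L.
    let F : Γ.V → ℝ := fun v => if Relation.EqvGen (fun a b => ∃ e' : (Γ.deleteEdge e).E,
      (Γ.deleteEdge e).src e' = a ∧ (Γ.deleteEdge e).tgt e' = b) (Γ.src e) v then 0 else 1
    have hFs : F (Γ.src e) = 0 := if_pos (Relation.EqvGen.refl _)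
    have hFt : F (Γ.tgt e) = 1 := if_neg fun h => hc (connected_deleteEdge hΓ.1 e h)
    have hE : (Γ.deleteEdge e).energy (fun v => k v (Γ.tgt e)) F = 0 := by
      refine Finset.sum_eq_zero fun e' _ => ?_
      have : F ((Γ.deleteEdge e).tgt e') = F ((Γ.deleteEdge e).src e') := by
        have hrel := Relation.EqvGen.rel (r := fun a b => ∃ e' : (Γ.deleteEdge e).E,
          (Γ.deleteEdge e).src e' = a ∧ (Γ.deleteEdge e).tgt e' = b) _ _ ⟨e', rfl, rfl⟩
        exact if_congr ⟨fun h => .trans _ _ _ h (.symm _ _ hrel), fun h => .trans _ _ _ h hrel⟩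
          rfl rfl
      rw [this, sub_self, mul_zero, zero_div]
    have h1 := (hsplit F).trans (congrArg (_ + ·) hE)
    simp only [hFs, hFt, sub_zero, mul_one, add_zero] at h1
    field_simp at h1
    linarith

end LengthGraph

namespace LengthGraph

/-! ### The contribution of one replaced edge -/

section Replacement

variable {β : LengthGraph.{u}} {p q : β.V} {g : β.V → β.V → ℝ}

/-- The harmonic function on `β` with value `0` at the ground and `1` at `q`. -/
noncomputable def harm (g : β.V → β.V → ℝ) (q x : β.V) : ℝ := g x q / g q q

theorem IsGreen.harm_ground (hg : β.IsGreen p g) : harm g q p = 0 := by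
  rw [harm, hg.ground, zero_div]

theorem harm_self (hq : g q q ≠ 0) : harm g q q = 1 := div_self hq

/-- The multiple by `c` of the Green function of `β` with zero boundary values at the ground and
at `q`. -/
noncomputable def dirichletGreen (c : ℝ) (g : β.V → β.V → ℝ) (q x y : β.V) : ℝ :=
  c * (g x y - harm g q x * harm g q y * g q q)

theorem dirichletGreen_comm (hg : β.IsGreen p g) (c : ℝ) (x y : β.V) :
    dirichletGreen c g q x y = dirichletGreen c g q y x := by
  rw [dirichletGreen, dirichletGreen, hg.symm x y]
  ring

theorem IsGreen.dirichletGreen_ground (hg : β.IsGreen p g) (c : ℝ) (y : β.V) :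
    dirichletGreen c g q p y = 0 := by
  rw [dirichletGreen, hg.harm_ground, hg.ground]
  ring

theorem IsGreen.dirichletGreen_self (hg : β.IsGreen p g) (hq : g q q ≠ 0) (c : ℝ) (y : β.V) :
    dirichletGreen c g q q y = 0 := by
  rw [dirichletGreen, harm_self hq, one_mul, harm, div_mul_cancel₀ _ hq, hg.symm q y]
  ring

theorem IsGreen.energy_harm (hg : β.IsGreen p g) (F : β.V → ℝ) :
    β.energy (harm g q) F = (F q - F p) / g q q := by
  have h : harm g q = fun x => (g q q)⁻¹ * g x q := by
    ext x; rw [harm, div_eq_inv_mul]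
  rw [h, energy_smul_left, hg.energy_eq, div_eq_inv_mul]

/-- Subtracting the harmonic multiple replaces F(y) - F(p) by F(y) minus the harmonic interpolation
of the boundary values. The factor c compensates the energy of the scaled copy, which is 1/c times
that of β. -/
theorem IsGreen.energy_dirichletGreen (hg : β.IsGreen p g) (hq : g q q ≠ 0) (c : ℝ) (y : β.V)
    (F : β.V → ℝ) :
    β.energy (fun x => dirichletGreen c g q x y) F =
      c * (F y - ((1 - harm g q y) * F p + harm g q y * F q)) := by
  have h : (fun x => dirichletGreen c g q x y) =
      fun x => c * g x y + (-(c * harm g q y * g q q)) * harm g q x := by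
    ext x; rw [dirichletGreen]; ring
  rw [h, energy_add_left, energy_smul_left, energy_smul_left, hg.energy_eq, hg.energy_harm]
  field_simp
  ring

/-- The sum over the edges of `β` that computes the contribution to the tau constant of an edge
replaced by `β`. Here `a`, `b` are the values at the end points of the diagonal of the Green
function, `r` is the resistance between the end points, and `c` is the scaling factor. -/
theorem IsGreen.sum_replacement (hg : β.IsGreen p g) (hβ : β.IsMetrizedGraph) (hq : g q q ≠ 0)
    {c : ℝ} (hc : c ≠ 0) (a b r : ℝ) {φ : β.V → ℝ} {ρ : β.V → β.V → ℝ}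
    (hφ : ∀ x, φ x = a * (1 - harm g q x) + b * harm g q x -
      harm g q x * (1 - harm g q x) * r + dirichletGreen c g q x x)
    (hρ : ∀ x y, ρ x y = kernelRes (dirichletGreen c g q) x y +
      (harm g q x - harm g q y) ^ 2 * r) :
    ∑ f : β.E, ((φ (β.tgt f) - φ (β.src f)) ^ 2 / (c * β.len f) +
        (c * β.len f - ρ (β.src f) (β.tgt f)) ^ 2 / (3 * (c * β.len f))) =
      (b - a) ^ 2 / (c * g q q) + (c * g q q - r) ^ 2 / (3 * (c * g q q)) +
        4 * c * tauSum g - c * g q q +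
        4 * (c * g q q - r) * β.A (.vertex p) (.vertex q) / g q q ^ 2 := by
  set R := g q q with hR
  set κ := c * R - r with hκ
  -- With h = `harm g q`, the hypotheses say φ = a + (b-a)h + c(g(x,x) - g(x,q)) + κh(1-h), and cL -
  -- ρ = c(L - r_β) + κ(Δh)² on an edge, where r_β is the resistance in β between its ends.
  -- Expanding the squares and removing the summands of τ(β) and A leaves the increment of g(·,q)
  -- times that of F, divided by L. The cubic term of F comes from (x+y)² + (y-x)²/3 =
  -- (4/3)(x²+xy+y²).
  let F : β.V → ℝ := fun x => ((b - a) / R) ^ 2 / c * g x q +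
    2 * ((b - a) / R) * (g x x - g x q) +
    2 * ((b - a) / R) * κ / c * (g x q / R - g x q ^ 2 / R ^ 2) -
    2 * c * g x x + c * g x q +
    κ ^ 2 / c * ((g x q - 2 * g x q ^ 2 / R + 4 * g x q ^ 3 / (3 * R ^ 2)) / R ^ 2) +
    2 * κ * ((g x x - g x q) / R - 2 * (g x x - g x q) * g x q / R ^ 2)
  -- The energy is F(q) - F(p). Here F(p) = 0, and at q both g(x,x) and g(x,q) equal R, which kills
  -- the mixed terms.
  have hF : β.energy (fun x => g x q) F =
      (b - a) ^ 2 / (c * R) + κ ^ 2 / (3 * (c * R)) - c * R := by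
    rw [hg.energy_eq]
    simp only [F, hg.ground, ← hR]
    field_simp
    ring
  rw [hg.A_eq hβ, tauSum]
  have hsum : ∑ f : β.E, ((φ (β.tgt f) - φ (β.src f)) ^ 2 / (c * β.len f) +
        (c * β.len f - ρ (β.src f) (β.tgt f)) ^ 2 / (3 * (c * β.len f))) =
      c * ∑ f : β.E, ((g (β.tgt f) (β.tgt f) - g (β.src f) (β.src f)) ^ 2 / β.len f +
        (β.len f - kernelRes g (β.src f) (β.tgt f)) ^ 2 / (3 * β.len f)) +
      4 * κ / R ^ 2 * ∑ f : β.E, (g (β.tgt f) q - g (β.src f) q) ^ 2 / β.len f *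
        ((g (β.src f) (β.src f) - g (β.src f) q + (g (β.tgt f) (β.tgt f) - g (β.tgt f) q)) / 2 +
          (β.len f - kernelRes g (β.src f) (β.tgt f)) / 6) +
      β.energy (fun x => g x q) F := by
    rw [energy, Finset.mul_sum, Finset.mul_sum, ← Finset.sum_add_distrib,
      ← Finset.sum_add_distrib]
    refine Finset.sum_congr rfl fun f _ => ?_
    have hL := (hβ.2 f).ne'
    simp only [hφ, hρ, F, kernelRes, dirichletGreen, harm, ← hR, hκ]
    generalize g (β.tgt f) q = y
    generalize g (β.src f) q = x
    generalize g (β.tgt f) (β.tgt f) = d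
    generalize g (β.src f) (β.src f) = d'
    generalize g (β.src f) (β.tgt f) = k
    generalize β.len f = L at hL
    field_simp
    ring
  rw [hsum, hF]
  ring

end Replacement

end LengthGraph

namespace LengthGraph

/-! ### The Green function of a full immersion -/

section Immersion

variable {Γ : LengthGraph.{u}} {β : Γ.E → LengthGraph.{u}} {p q : ∀ e, (β e).V}

theorem immersionVertex_p (e : Γ.E) : Γ.immersionVertex β p q e (p e) = .inl (Γ.src e) := by
  simp [immersionVertex]

theorem immersionVertex_q (hpq : ∀ e, p e ≠ q e) (e : Γ.E) :
    Γ.immersionVertex β p q e (q e) = .inl (Γ.tgt e) := by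
  simp [immersionVertex, (hpq e).symm]

theorem immersionVertex_of_ne {e : Γ.E} {v : (β e).V} (hv : v ≠ p e ∧ v ≠ q e) :
    Γ.immersionVertex β p q e v = .inr ⟨e, v, hv⟩ := by
  simp [immersionVertex, hv]

theorem sum_fullImmersion (f : (Σ e : Γ.E, (β e).E) → ℝ) :
    ∑ a : (Γ.fullImmersion β p q).E, f a = ∑ e : Γ.E, ∑ b : (β e).E, f ⟨e, b⟩ :=
  Fintype.sum_sigma f

/-- The ratio of the lengths in the copy of `β e` in the full immersion to those in `β e`. -/
noncomputable def copyScale (g : ∀ e, (β e).V → (β e).V → ℝ) (q : ∀ e, (β e).V) (e : Γ.E) : ℝ :=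
  Γ.len e / g e (q e) (q e)

/-- The extension of a function on the vertices of `Γ` that is harmonic in each copy. -/
noncomputable def harmExt (g : ∀ e, (β e).V → (β e).V → ℝ) (u : Γ.V → ℝ) :
    Γ.ImmersionVertex β p q → ℝ
  | .inl v => u v
  | .inr ⟨e, v, _⟩ => (1 - harm (g e) (q e) v) * u (Γ.src e) + harm (g e) (q e) v * u (Γ.tgt e)

open Classical in
/-- The restriction to the copy of `β e` of the Dirichlet Green function with pole `y`. -/
noncomputable def copyGreen (g : ∀ e, (β e).V → (β e).V → ℝ) (e : Γ.E) (x : (β e).V) :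
    Γ.ImmersionVertex β p q → ℝ
  | .inl _ => 0
  | .inr ⟨e', v, _⟩ =>
    if h : e' = e then dirichletGreen (copyScale g q e) (g e) (q e) x (h ▸ v) else 0

/-- The Dirichlet Green function of the complement of the vertices of `Γ`. -/
noncomputable def innerGreen (g : ∀ e, (β e).V → (β e).V → ℝ) :
    Γ.ImmersionVertex β p q → Γ.ImmersionVertex β p q → ℝ
  | .inl _, _ => 0
  | .inr ⟨e, v, _⟩, y => copyGreen g e v y

/-- The Green function of the full immersion, built from those of `Γ` and of the `β e`. -/
noncomputable def immersionGreen (G : Γ.V → Γ.V → ℝ) (g : ∀ e, (β e).V → (β e).V → ℝ)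
    (x y : Γ.ImmersionVertex β p q) : ℝ :=
  harmExt g (fun v => harmExt g (G v) y) x + innerGreen g x y

variable {o : Γ.V} {G : Γ.V → Γ.V → ℝ} {g : ∀ e, (β e).V → (β e).V → ℝ}

/-- The boundary values 0 and 1 of `harm` make the formula for inner vertices valid also at the two
glued terminals. -/
theorem harmExt_immersionVertex (hpq : ∀ e, p e ≠ q e) (hg : ∀ e, (β e).IsGreen (p e) (g e))
    (hq : ∀ e, g e (q e) (q e) ≠ 0) (u : Γ.V → ℝ) (e : Γ.E) (x : (β e).V) :
    harmExt g u (Γ.immersionVertex β p q e x) =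
      (1 - harm (g e) (q e) x) * u (Γ.src e) + harm (g e) (q e) x * u (Γ.tgt e) := by
  by_cases hx : x = p e
  · subst hx
    rw [immersionVertex_p, (hg e).harm_ground, harmExt]
    ring
  by_cases hx' : x = q e
  · subst hx'
    rw [immersionVertex_q hpq, harm_self (hq e), harmExt]
    ring
  rw [immersionVertex_of_ne ⟨hx, hx'⟩, harmExt]

theorem immersionGreen_immersionVertex_left (hpq : ∀ e, p e ≠ q e)
    (hg : ∀ e, (β e).IsGreen (p e) (g e)) (hq : ∀ e, g e (q e) (q e) ≠ 0) (e : Γ.E) (x : (β e).V)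
    (y : Γ.ImmersionVertex β p q) :
    immersionGreen G g (Γ.immersionVertex β p q e x) y =
      (1 - harm (g e) (q e) x) * harmExt g (G (Γ.src e)) y +
        harm (g e) (q e) x * harmExt g (G (Γ.tgt e)) y + copyGreen g e x y := by
  rw [immersionGreen, harmExt_immersionVertex hpq hg hq]
  congr 1
  by_cases hx : x = p e
  · subst hx
    rw [immersionVertex_p, innerGreen]
    rcases y with v | ⟨e', v, hv⟩
    · rfl
    · simp only [copyGreen, (hg e).dirichletGreen_ground, dite_eq_ite, ite_self]
  by_cases hx' : x = q e
  · subst hx'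
    rw [immersionVertex_q hpq, innerGreen]
    rcases y with v | ⟨e', v, hv⟩
    · rfl
    · simp only [copyGreen, (hg e).dirichletGreen_self (hq e), dite_eq_ite, ite_self]
  rw [immersionVertex_of_ne ⟨hx, hx'⟩, innerGreen]

theorem copyGreen_immersionVertex (hpq : ∀ e, p e ≠ q e) (hg : ∀ e, (β e).IsGreen (p e) (g e))
    (hq : ∀ e, g e (q e) (q e) ≠ 0) (e : Γ.E) (x y : (β e).V) :
    copyGreen g e x (Γ.immersionVertex β p q e y) =
      dirichletGreen (copyScale g q e) (g e) (q e) x y := by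
  by_cases hy : y = p e
  · subst hy
    rw [immersionVertex_p, dirichletGreen_comm (hg e), (hg e).dirichletGreen_ground, copyGreen]
  by_cases hy' : y = q e
  · subst hy'
    rw [immersionVertex_q hpq, dirichletGreen_comm (hg e), (hg e).dirichletGreen_self (hq e),
      copyGreen]
  rw [immersionVertex_of_ne ⟨hy, hy'⟩, copyGreen]
  simp

theorem immersionGreen_immersionVertex (hpq : ∀ e, p e ≠ q e)
    (hg : ∀ e, (β e).IsGreen (p e) (g e)) (hq : ∀ e, g e (q e) (q e) ≠ 0) (e : Γ.E)
    (x y : (β e).V) :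
    immersionGreen G g (Γ.immersionVertex β p q e x) (Γ.immersionVertex β p q e y) =
      (1 - harm (g e) (q e) x) * ((1 - harm (g e) (q e) y) * G (Γ.src e) (Γ.src e) +
        harm (g e) (q e) y * G (Γ.src e) (Γ.tgt e)) +
      harm (g e) (q e) x * ((1 - harm (g e) (q e) y) * G (Γ.tgt e) (Γ.src e) +
        harm (g e) (q e) y * G (Γ.tgt e) (Γ.tgt e)) +
      dirichletGreen (copyScale g q e) (g e) (q e) x y := by
  rw [immersionGreen_immersionVertex_left hpq hg hq, harmExt_immersionVertex hpq hg hq,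
    harmExt_immersionVertex hpq hg hq, copyGreen_immersionVertex hpq hg hq]

theorem IsGreen.energy_harmExt (hG : Γ.IsGreen o G) (y : Γ.ImmersionVertex β p q) (F : Γ.V → ℝ) :
    Γ.energy (fun v => harmExt g (G v) y) F = harmExt g F y - F o := by
  rcases y with w | ⟨e, w, hw⟩
  · exact hG.energy_eq w F
  · simp only [harmExt]
    rw [energy_add_left, energy_smul_left, energy_smul_left, hG.energy_eq, hG.energy_eq]
    ring

/-- Only the copy containing y contributes, and its Dirichlet Green function reproduces F up to the
harmonic interpolation of F between the terminals. -/
theorem sum_energy_copyGreen (hpq : ∀ e, p e ≠ q e) (hg : ∀ e, (β e).IsGreen (p e) (g e))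
    (hq : ∀ e, g e (q e) (q e) ≠ 0) (hl : ∀ e, Γ.len e ≠ 0) (y : Γ.ImmersionVertex β p q)
    (F : Γ.ImmersionVertex β p q → ℝ) :
    ∑ e : Γ.E, (copyScale g q e)⁻¹ * (β e).energy (fun x => copyGreen g e x y)
      (fun x => F (Γ.immersionVertex β p q e x)) = F y - harmExt g (fun v => F (.inl v)) y := by
  rcases y with w | ⟨e, w, hw⟩
  · simp [copyGreen, harmExt, energy]
  · rw [Finset.sum_eq_single e]
    · have hc : copyScale g q e ≠ 0 := div_ne_zero (hl e) (hq e)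
      simp only [copyGreen, dite_true]
      rw [(hg e).energy_dirichletGreen (hq e), inv_mul_cancel_left₀ hc, immersionVertex_of_ne hw,
        immersionVertex_p, immersionVertex_q hpq, harmExt]
    · intro e' _ he
      simp [copyGreen, he.symm, energy]
    · simp

/-- The factor in `scaledCopy` in terms of Green functions. -/
theorem len_fullImmersion (hβ : ∀ e, (β e).IsMetrizedGraph)
    (hg : ∀ e, (β e).IsGreen (p e) (g e)) (e : Γ.E) (b : (β e).E) :
    (Γ.fullImmersion β p q).len ⟨e, b⟩ = copyScale g q e * (β e).len b := by
  change Γ.len e / (β e).resistance (.vertex (p e)) (.vertex (q e)) * (β e).len b = _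
  rw [(hg e).resistance_vertex (hβ e), (hg e).kernelRes_ground, copyScale]

theorem energy_fullImmersion (hβ : ∀ e, (β e).IsMetrizedGraph)
    (hg : ∀ e, (β e).IsGreen (p e) (g e)) (F H : Γ.ImmersionVertex β p q → ℝ) :
    (Γ.fullImmersion β p q).energy F H = ∑ e : Γ.E, (copyScale g q e)⁻¹ *
      (β e).energy (fun x => F (Γ.immersionVertex β p q e x))
        (fun x => H (Γ.immersionVertex β p q e x)) := by
  unfold energy
  refine (sum_fullImmersion _).trans (Finset.sum_congr rfl fun e _ => ?_)
  rw [Finset.mul_sum]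
  refine Finset.sum_congr rfl fun b _ => ?_
  rw [len_fullImmersion hβ hg, div_mul_eq_div_div_swap, inv_mul_eq_div]
  rfl

/-- In each copy the harmonic part sees only the increment of F between the terminals, with
conductance 1/`len e`, so it adds up to an energy on Γ equal to the harmonic extension of F at y
minus F(o). The Dirichlet parts supply F(y) minus that extension. -/
theorem IsGreen.sum_energy_immersionGreen (hG : Γ.IsGreen o G) (hl : ∀ e, Γ.len e ≠ 0)
    (hpq : ∀ e, p e ≠ q e) (hg : ∀ e, (β e).IsGreen (p e) (g e))
    (hq : ∀ e, g e (q e) (q e) ≠ 0) (y : Γ.ImmersionVertex β p q)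
    (F : Γ.ImmersionVertex β p q → ℝ) :
    ∑ e : Γ.E, (copyScale g q e)⁻¹ *
      (β e).energy (fun x => immersionGreen G g (Γ.immersionVertex β p q e x) y)
        (fun x => F (Γ.immersionVertex β p q e x)) = F y - F (.inl o) := by
  have h : ∀ e : Γ.E, (copyScale g q e)⁻¹ * (β e).energy
      (fun x => immersionGreen G g (Γ.immersionVertex β p q e x) y)
      (fun x => F (Γ.immersionVertex β p q e x)) =
      (harmExt g (G (Γ.tgt e)) y - harmExt g (G (Γ.src e)) y) *
        (F (.inl (Γ.tgt e)) - F (.inl (Γ.src e))) / Γ.len e +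
      (copyScale g q e)⁻¹ * (β e).energy (fun x => copyGreen g e x y)
        (fun x => F (Γ.immersionVertex β p q e x)) := by
    intro e
    have h1 : (fun x => immersionGreen G g (Γ.immersionVertex β p q e x) y) =
        fun x => (harmExt g (G (Γ.tgt e)) y - harmExt g (G (Γ.src e)) y) * harm (g e) (q e) x +
          copyGreen g e x y + harmExt g (G (Γ.src e)) y := by
      ext x
      rw [immersionGreen_immersionVertex_left hpq hg hq]
      ring
    have h2 : ∀ (H K : (β e).V → ℝ) (c : ℝ),
        (β e).energy (fun x => H x + c) K = (β e).energy H K := fun H K c =>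
      Finset.sum_congr rfl fun f _ => by ring
    rw [h1, h2, energy_add_left, energy_smul_left, (hg e).energy_harm, immersionVertex_p,
      immersionVertex_q hpq, copyScale]
    have := hq e
    have := hl e
    field_simp
  rw [Finset.sum_congr rfl fun e _ => h e, Finset.sum_add_distrib,
    sum_energy_copyGreen hpq hg hq hl y F]
  have h3 := hG.energy_harmExt (g := g) y (fun v => F (.inl v))
  rw [energy] at h3
  rw [h3]
  ring

theorem IsGreen.immersionGreen (hG : Γ.IsGreen o G) (hl : ∀ e, Γ.len e ≠ 0)
    (hβ : ∀ e, (β e).IsMetrizedGraph) (hpq : ∀ e, p e ≠ q e)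
    (hg : ∀ e, (β e).IsGreen (p e) (g e)) (hq : ∀ e, g e (q e) (q e) ≠ 0) :
    (Γ.fullImmersion β p q).IsGreen (.inl o) (LengthGraph.immersionGreen G g) where
  ground y := by
    change harmExt g (G o) y + 0 = 0
    rcases y with w | ⟨e, w, hw⟩ <;> simp [harmExt, hG.ground]
  energy_eq y F := (energy_fullImmersion hβ hg _ F).trans
    (hG.sum_energy_immersionGreen hl hpq hg hq y F)

/-- The tau constant of a full immersion in terms of Green functions. -/
theorem tauSum_immersionGreen (hG : Γ.IsGreen o G) (hl : ∀ e, Γ.len e ≠ 0)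
    (hβ : ∀ e, (β e).IsMetrizedGraph) (hpq : ∀ e, p e ≠ q e)
    (hg : ∀ e, (β e).IsGreen (p e) (g e)) (hq : ∀ e, g e (q e) (q e) ≠ 0) :
    tauSum (Γ := Γ.fullImmersion β p q) (immersionGreen G g) =
      tauSum G - 1 / 4 * Γ.totalLength + ∑ e : Γ.E, (copyScale g q e * tauSum (g e) +
        (Γ.len e - kernelRes G (Γ.src e) (Γ.tgt e)) *
          (β e).A (.vertex (p e)) (.vertex (q e)) / g e (q e) (q e) ^ 2) := by
  have h := fun e => (hg e).sum_replacement (hβ e) (hq e) (div_ne_zero (hl e) (hq e))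
    (G (Γ.src e) (Γ.src e)) (G (Γ.tgt e) (Γ.tgt e)) (kernelRes G (Γ.src e) (Γ.tgt e))
    (φ := fun x => immersionGreen G g (Γ.immersionVertex β p q e x)
      (Γ.immersionVertex β p q e x))
    (ρ := fun x y => kernelRes (immersionGreen G g) (Γ.immersionVertex β p q e x)
      (Γ.immersionVertex β p q e y))
    (fun x => by
      rw [immersionGreen_immersionVertex hpq hg hq, hG.symm (Γ.tgt e) (Γ.src e), kernelRes,
        copyScale]
      ring)
    (fun x y => by
      simp only [kernelRes, immersionGreen_immersionVertex hpq hg hq,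
        hG.symm (Γ.tgt e) (Γ.src e), copyScale]
      ring)
  unfold tauSum
  rw [totalLength, Finset.mul_sum, Finset.mul_sum, Finset.mul_sum, ← Finset.sum_sub_distrib,
    ← Finset.sum_add_distrib]
  refine (sum_fullImmersion _).trans (Finset.sum_congr rfl fun e _ => ?_)
  rw [← Finset.mul_sum]
  have h' := h e
  -- The scaling makes c g(q,q) equal to `len e`, so the first two terms become the summand of e in
  -- `tauSum G`.
  simp only [div_mul_cancel₀ _ (hq e)] at h'
  refine (congrArg (1 / 4 * ·) (Eq.trans (Finset.sum_congr rfl fun b _ => ?_) h')).trans ?_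
  · rw [len_fullImmersion hβ hg, copyScale]
    rfl
  · rw [tauSum, copyScale]
    ring

/-! ### Normalization -/

theorem Connected.fullImmersion (hΓ : Γ.Connected) (hβ : ∀ e, (β e).Connected)
    (hpq : ∀ e, p e ≠ q e) : (Γ.fullImmersion β p q).Connected := by
  set r : Γ.ImmersionVertex β p q → Γ.ImmersionVertex β p q → Prop :=
    fun a b => ∃ e : (Γ.fullImmersion β p q).E,
      (Γ.fullImmersion β p q).src e = a ∧ (Γ.fullImmersion β p q).tgt e = b
  have hcopy : ∀ e (x y : (β e).V), Relation.EqvGen r (Γ.immersionVertex β p q e x)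
      (Γ.immersionVertex β p q e y) := by
    intro e x y
    induction (hβ e).2 x y with
    | rel x y h =>
      obtain ⟨f, rfl, rfl⟩ := h
      exact .rel _ _ ⟨⟨e, f⟩, rfl, rfl⟩
    | refl x => exact .refl _
    | symm x y _ ih => exact .symm _ _ ih
    | trans x y z _ _ ih₁ ih₂ => exact .trans _ _ _ ih₁ ih₂
  have hinl : ∀ u v : Γ.V, Relation.EqvGen r (.inl u) (.inl v) := by
    intro u v
    induction hΓ.2 u v with
    | rel x y h =>
      obtain ⟨e, rfl, rfl⟩ := h
      have := hcopy e (p e) (q e)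
      rwa [immersionVertex_p, immersionVertex_q hpq] at this
    | refl x => exact .refl _
    | symm x y _ ih => exact .symm _ _ ih
    | trans x y z _ _ ih₁ ih₂ => exact .trans _ _ _ ih₁ ih₂
  obtain ⟨v₀⟩ := hΓ.1
  have hbase : ∀ x, Relation.EqvGen r x (.inl v₀) := by
    rintro (v | ⟨e, v, hv⟩)
    · exact hinl v v₀
    · have := hcopy e v (p e)
      rw [immersionVertex_of_ne hv, immersionVertex_p] at this
      exact .trans _ _ _ this (hinl _ v₀)
  exact ⟨⟨.inl v₀⟩, fun u v => .trans _ _ _ (hbase u) (.symm _ _ (hbase v))⟩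

end Immersion

section Normalization

variable {Γ : LengthGraph.{u}}

theorem totalLength_scale (c : ℝ) : (Γ.scale c).totalLength = c * Γ.totalLength :=
  (Finset.mul_sum ..).symm

theorem IsMetrizedGraph.scale (hΓ : Γ.IsMetrizedGraph) {c : ℝ} (hc : 0 < c) :
    (Γ.scale c).IsMetrizedGraph :=
  ⟨hΓ.1, fun e => mul_pos hc (hΓ.2 e)⟩

theorem tauSum_scale (g : Γ.V → Γ.V → ℝ) {c : ℝ} (hc : c ≠ 0) :
    tauSum (Γ := Γ.scale c) (fun x y => c * g x y) = c * tauSum g := by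
  have h : ∀ e : Γ.E,
      (c * g (Γ.tgt e) (Γ.tgt e) - c * g (Γ.src e) (Γ.src e)) ^ 2 / (c * Γ.len e) +
        (c * Γ.len e - kernelRes (fun x y => c * g x y) (Γ.src e) (Γ.tgt e)) ^ 2 /
          (3 * (c * Γ.len e)) =
      c * ((g (Γ.tgt e) (Γ.tgt e) - g (Γ.src e) (Γ.src e)) ^ 2 / Γ.len e +
        (Γ.len e - kernelRes g (Γ.src e) (Γ.tgt e)) ^ 2 / (3 * Γ.len e)) := by
    intro e
    -- Lengths are not assumed positive here; at length zero both sides vanish by the convention for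
    -- division by zero.
    rcases eq_or_ne (Γ.len e) 0 with h0 | h0
    · simp [h0]
    · simp only [kernelRes]
      field_simp
  refine (congrArg (1 / 4 * ·) ((Finset.sum_congr rfl fun e _ => h e).trans
    (Finset.mul_sum (Finset.univ : Finset Γ.E) _ c).symm)).trans ?_
  rw [tauSum]
  ring

/-- The tau constant is homogeneous of degree one in the lengths. -/
theorem IsMetrizedGraph.tau_scale (hΓ : Γ.IsMetrizedGraph) {c : ℝ} (hc : 0 < c) :
    (Γ.scale c).tau = c * Γ.tau := by
  obtain ⟨o⟩ := hΓ.1.1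
  obtain ⟨g, hg⟩ := hΓ.exists_isGreen o
  rw [(hg.scale hc.ne').tau_eq (hΓ.scale hc), hg.tau_eq hΓ, tauSum_scale g hc.ne']

theorem IsMetrizedGraph.isNormalized_normalization (hΓ : Γ.IsMetrizedGraph)
    (h : 0 < Γ.totalLength) : Γ.normalization.IsNormalized := by
  refine ⟨hΓ.scale (one_div_pos.2 h), ?_⟩
  rw [normalization, totalLength_scale, one_div_mul_cancel h.ne']

theorem IsMetrizedGraph.tau_normalization_mul (hΓ : Γ.IsMetrizedGraph)
    (h : 0 < Γ.totalLength) : Γ.normalization.tau * Γ.totalLength = Γ.tau := by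
  rw [normalization, hΓ.tau_scale (one_div_pos.2 h), mul_right_comm, one_div_mul_cancel h.ne',
    one_mul]

theorem IsMetrizedGraph.resistance_pos (hΓ : Γ.IsMetrizedGraph) {p q : Γ.V} (hpq : p ≠ q) :
    0 < Γ.resistance (.vertex p) (.vertex q) := by
  obtain ⟨g, hg⟩ := hΓ.exists_isGreen p
  rw [hg.resistance_vertex hΓ, hg.kernelRes_ground]
  exact hg.diag_pos hΓ hpq.symm

theorem fullImmersion_tau (Γ : LengthGraph.{u}) (β : Γ.E → LengthGraph.{u}) (p q : ∀ e, (β e).V)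
    (hΓ : Γ.IsNormalized) (hβ : ∀ e, (β e).IsNormalized) (hpq : ∀ e, p e ≠ q e) :
    (Γ.fullImmersion β p q).normalization.IsNormalized ∧
      (Γ.fullImmersion β p q).normalization.tau *
          ∑ e : Γ.E, Γ.len e / (β e).resistance (.vertex (p e)) (.vertex (q e)) =
        Γ.tau - 1 / 4 +
          ∑ e : Γ.E,
            (Γ.len e * (β e).tau / (β e).resistance (.vertex (p e)) (.vertex (q e)) +
              Γ.len e ^ 2 * (β e).A (.vertex (p e)) (.vertex (q e)) * Γ.invLenAddRes e /
                (β e).resistance (.vertex (p e)) (.vertex (q e)) ^ 2) := by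
  obtain ⟨⟨o⟩, -⟩ := hΓ.1.1
  have hl := fun e => (hΓ.1.2 e).ne'
  have hβ' := fun e => (hβ e).1
  obtain ⟨G, hG⟩ := hΓ.1.exists_isGreen o
  choose g hg using fun e => (hβ' e).exists_isGreen (p e)
  have hr : ∀ e, (β e).resistance (.vertex (p e)) (.vertex (q e)) = g e (q e) (q e) := fun e => by
    rw [(hg e).resistance_vertex (hβ' e), (hg e).kernelRes_ground]
  have hq : ∀ e, 0 < g e (q e) (q e) := fun e => (hg e).diag_pos (hβ' e) (hpq e).symm
  have hM : (Γ.fullImmersion β p q).IsMetrizedGraph := by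
    refine ⟨hΓ.1.1.fullImmersion (fun e => (hβ' e).1) hpq, fun a => ?_⟩
    change 0 < Γ.len a.1 / _ * (β a.1).len a.2
    rw [hr]
    exact mul_pos (div_pos (hΓ.1.2 _) (hq _)) ((hβ' _).2 _)
  -- Each `β e` has total length 1, so the length of its copy is the scaling factor.
  have htot : (Γ.fullImmersion β p q).totalLength =
      ∑ e : Γ.E, Γ.len e / (β e).resistance (.vertex (p e)) (.vertex (q e)) := by
    refine (sum_fullImmersion (p := p) (q := q) _).trans (Finset.sum_congr rfl fun e _ => ?_)
    refine (Finset.mul_sum (Finset.univ : Finset (β e).E) (β e).len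
      (Γ.len e / (β e).resistance (.vertex (p e)) (.vertex (q e)))).symm.trans ?_
    rw [show ∑ b, (β e).len b = 1 from (hβ e).2, mul_one]
  have hpos : 0 < (Γ.fullImmersion β p q).totalLength := by
    rw [htot]
    refine Finset.sum_pos (fun e _ => ?_) ?_
    · rw [hr]
      exact div_pos (hΓ.1.2 e) (hq e)
    -- Total length 1 forces Γ to have an edge.
    · by_contra h
      have h1 := hΓ.2
      rw [totalLength, Finset.not_nonempty_iff_eq_empty.1 h, Finset.sum_empty] at h1
      exact zero_ne_one h1
  refine ⟨hM.isNormalized_normalization hpos, ?_⟩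
  rw [← htot, hM.tau_normalization_mul hpos,
    (hG.immersionGreen hl hβ' hpq hg fun e => (hq e).ne').tau_eq hM,
    tauSum_immersionGreen hG hl hβ' hpq hg fun e => (hq e).ne', ← hG.tau_eq hΓ.1, hΓ.2, mul_one]
  congr 1
  refine Finset.sum_congr rfl fun e _ => ?_
  rw [hr, ← (hg e).tau_eq (hβ' e), ← hG.len_sq_mul_invLenAddRes hΓ.1, copyScale]
  ring

end Normalization

end LengthGraph

/-! ### The two formulas, the first as the case of identical copies -/

theorem mainTheorem1 :
    (∀ (Γ β : LengthGraph.{u}) (p q : β.V),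
      Γ.IsNormalized → β.IsNormalized → p ≠ q →
      (Γ.fullImmersion (fun _ => β) (fun _ => p) (fun _ => q)).normalization.IsNormalized ∧
      (Γ.fullImmersion (fun _ => β) (fun _ => p) (fun _ => q)).normalization.tau =
        β.tau - β.resistance (.vertex p) (.vertex q) / 4
          + β.resistance (.vertex p) (.vertex q) * Γ.tau
          + β.A (.vertex p) (.vertex q) / β.resistance (.vertex p) (.vertex q) *
            ∑ e : Γ.E, Γ.len e ^ 2 * Γ.invLenAddRes e) ∧
    (∀ (Γ : LengthGraph.{u}) (β : Γ.E → LengthGraph.{u}) (p q : ∀ e, (β e).V),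
      Γ.IsNormalized → (∀ e, (β e).IsNormalized) → (∀ e, p e ≠ q e) →
      (Γ.fullImmersion β p q).normalization.IsNormalized ∧
      (Γ.fullImmersion β p q).normalization.tau *
          ∑ e : Γ.E, Γ.len e / (β e).resistance (.vertex (p e)) (.vertex (q e)) =
        Γ.tau - 1 / 4 +
          ∑ e : Γ.E,
            (Γ.len e * (β e).tau / (β e).resistance (.vertex (p e)) (.vertex (q e)) +
              Γ.len e ^ 2 * (β e).A (.vertex (p e)) (.vertex (q e)) * Γ.invLenAddRes e /
                (β e).resistance (.vertex (p e)) (.vertex (q e)) ^ 2)) := by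
  refine ⟨fun Γ β p q hΓ hβ hpq => ?_, LengthGraph.fullImmersion_tau⟩
  obtain ⟨h1, h2⟩ := Γ.fullImmersion_tau (fun _ => β) (fun _ => p) (fun _ => q) hΓ
    (fun _ => hβ) (fun _ => hpq)
  refine ⟨h1, ?_⟩
  have hr := (hβ.1.resistance_pos hpq).ne'
  have hlen : ∑ e : Γ.E, Γ.len e = 1 := hΓ.2
  -- For a single β the factor on the left is 1/r, because Γ has length 1; clearing r gives the
  -- first formula.
  rw [← Finset.sum_div, hlen, Finset.sum_add_distrib, ← Finset.sum_div, ← Finset.sum_div,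
    ← Finset.sum_mul, hlen] at h2
  have h3 : ∑ e : Γ.E, Γ.len e ^ 2 * β.A (.vertex p) (.vertex q) * Γ.invLenAddRes e =
      β.A (.vertex p) (.vertex q) * ∑ e : Γ.E, Γ.len e ^ 2 * Γ.invLenAddRes e := by
    rw [Finset.mul_sum]
    exact Finset.sum_congr rfl fun e _ => by ring
  rw [h3] at h2
  field_simp at h2 ⊢
  linarith
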